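/- **Theorem (Robust DistinctElements).** *Model.* Let $n\ge 2$. An insertion-only stream over $[n]$ is a sequence of updates $(a_t,\Delta_t)\in[n]\times\mathbb Z_{\ge 0}$; after $t$ updates its frequency vector is $f^{(t)}_i=\sum_{j\le t,\ a_j=i}\Delta_j$, and $\|f^{(t)}\|_0=|\{i: f^{(t)}_i\neq 0\}|$. A randomized streaming algorithm using $s$ bits of space has a memory in $\{0,1\}^s$; the memory is initialized using fair random bits, each update replaces the memory by a function of the old memory, the update and fresh fair random bits (random bits that are to be reused must be stored in the memory), and the response $R_t\in\mathbb Q$ is a function of the memory after the $t$-th update. An adversary chooses each update $(a_t,\Delta_t)$, possibly at random and with unbounded computational power, depending on all previous updates and all previous responses $R_1,\dots,R_{t-1}$. *Claim.* There is an absolute constant $C>0$ such that for all integers $n\ge 2$ and all real $\varepsilon,\delta\in(0,1)$ there is a randomized streaming algorithm such that, against every adversary and for every stream length $m$, with probability at least $1-\delta$, $$|R_t-\|f^{(t)}\|_0|\le \varepsilon\,\|f^{(t)}\|_0\qquad\text{simultaneously for all } t=1,\dots,m,$$ and the number of bits of space it uses is at most $$C\cdot\frac{\log (2/\varepsilon)}{\varepsilon}\left(\frac{\log(1/\varepsilon)+\log(1/\delta)+\log\log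 n}{\varepsilon^{2}}+\log n\right),$$ where $\log=\log_2$. (For $\varepsilon\le 1/2$ the factor $\log(2/\varepsilon)$ may be replaced by $\log(1/\varepsilon)$, at the cost of a factor $2$ in $C$.) -/

import Mathlib

namespace RobustStreaming

/-- An update `(a, Δ)` of an insertion-only stream over the universe `[n]`: the coordinate `a` of
the frequency vector is increased by `Δ ≥ 0`. -/
abbrev Update (n : ℕ) : Type := Fin n × ℕ

/-- The frequency vector of a finite stream of updates, `f i = ∑_{t : a_t = i} Δ_t`. -/
def freq {n : ℕ} (us : List (Update n)) (i : Fin n) : ℕ :=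
  ((us.filter (fun u => u.1 = i)).map Prod.snd).sum

/-- `‖f‖₀`, the number of nonzero coordinates of `f` (the number of distinct elements). -/
def l0 {n : ℕ} (f : Fin n → ℕ) : ℕ :=
  (Finset.univ.filter (fun i => f i ≠ 0)).card

/-- The uniform distribution on strings of `r` independent fair random bits. -/
noncomputable def fairCoins (r : ℕ) : PMF (Fin r → Bool) :=
  PMF.uniformOfFintype (Fin r → Bool)

/-- A randomized one-pass streaming algorithm over the universe `[n]`.
Everything that survives from one update to the next (sketches, counters, and all random bits
that are to be used again, such as the seeds of hash functions) has to be stored in a memory of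
`bits` bits.  The initialization and every update may use fresh fair coins; the coins used earlier
are not accessible later unless they have been stored.  The response to a query is computed from
the contents of the memory. -/
structure StreamingAlgorithm (n : ℕ) where
  /-- the space used, in bits -/
  bits : ℕ
  /-- the number of fresh fair coins available in one step -/
  coins : ℕ
  /-- the initial contents of the memory -/
  init : (Fin coins → Bool) → (Fin bits → Bool)
  /-- the new contents of the memory after an update -/
  update : (Fin bits → Bool) → Update n → (Fin coins → Bool) → (Fin bits → Bool)
  /-- the response -/
  output : (Fin bits → Bool) → ℚ

/-- The history of the game: the pairs (update submitted, response given), in order of time. -/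
abbrev Transcript (n : ℕ) : Type := List (Update n × ℚ)

/-- A (randomized, computationally unbounded, adaptive) adversary: the distribution of the next
update is an arbitrary function of the previous updates and responses. -/
abbrev Adversary (n : ℕ) : Type := Transcript n → PMF (Update n)

/-- The joint distribution of the contents of the memory and of the transcript after `t` rounds of
the game.  In each round the adversary submits an update chosen on the basis of the transcript, the
algorithm updates its memory with fresh coins and responds, and the adversary sees the response. -/
noncomputable def game {n : ℕ} (A : StreamingAlgorithm n) (adv : Adversary n) :
    ℕ → PMF ((Fin A.bits → Bool) × Transcript n)
  | 0 => (fairCoins A.coins).map (fun c => (A.init c, []))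
  | t + 1 =>
      (game A adv t).bind fun p =>
        (adv p.2).bind fun u =>
          (fairCoins A.coins).map fun c =>
            (A.update p.1 u c, p.2 ++ [(u, A.output (A.update p.1 u c))])

/-- At every time step `t` of the transcript, the response `R_t` is a `(1 ± ε)`-approximation of
`‖f^(t)‖₀`, where `f^(t)` is the frequency vector of the first `t` updates. -/
def AllAccurate {n : ℕ} (ε : ℝ) (h : Transcript n) : Prop :=
  ∀ (t : ℕ) (ht : t < h.length),
    |((h[t].2 : ℚ) : ℝ) - (l0 (freq ((h.take (t + 1)).map Prod.fst)) : ℝ)|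
      ≤ ε * (l0 (freq ((h.take (t + 1)).map Prod.fst)) : ℝ)

/-- `A` is adversarially robust for distinct elements: against every adversary, for a stream of
any length `m`, with probability at least `1 - δ` all `m` responses are
`(1 ± ε)`-approximations. -/
def RobustDistinctElements {n : ℕ} (A : StreamingAlgorithm n) (ε δ : ℝ) : Prop :=
  ∀ (m : ℕ) (adv : Adversary n),
    ENNReal.ofReal (1 - δ) ≤
      (game A adv m).toOuterMeasure {p | AllAccurate ε p.2}

end RobustStreaming

/-!
The proof analyses a sketch-switching algorithm.  The response is always one of the values
`0 = a₀ < a₁ < …` (`levelValue`), where `a_{j+1} ≈ (1 + ε) a_j`; the number `j` of the current value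
is the level.  It is increased when a tester for "more than `a_j` distinct elements" fires.  If
testers fire neither too early nor too late, then at level `j` the number of distinct elements lies
strictly between `a_{j-1}` and `a_{j+1}`, where `a_j` is an accurate response
(`abs_levelValue_sub_le`).

Robustness comes from using every tester for one response change only: until the tester of level
`j` fires, the responses, and hence the stream, do not depend on its seed, except through the fact
that it has not fired.  Firing is monotone in the set that the tester has seen.  So only two sets
matter for a tester, the last one that is too small to fire on and the first one on which it is
overdue, and no union bound over time is needed.  `quietFail_bound` makes this precise by
induction on the number of remaining rounds; it averages over the seeds that have not been used.

There are about `log n / ε` levels, but only `log (1 / ε) / ε` testers are stored at a time: a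
tester may be started when the number of distinct elements is still an `ε / 4`-fraction of its
target (`mul_levelValue_le_of_missed`), so that the elements it misses do not matter.

A tester is a random hash function with a bitmap; each bit of the bitmap tells whether the set seen
so far meets some random set in which every element lies with probability `1 - exp (-1 / a_j)`.
Hence the numbers of zero bits of a set with at most `a_j` elements and of one with at least
`(1 + ε / 4) a_j` elements are separated, by a Chernoff bound, already for
`log (1 / δ') / ε ^ 2` bits.  A fully random hash function would be too long to be stored, but there
are only `2 ^ n` sets, so a sample of `O(n / δ')` hash functions is as good for all of them
(`exists_family_card_bad_le`, `exists_hash_family`), and a seed of `log n + log (1 / δ') + O(1)`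
bits names one of the sample.  With `δ'` of the order of `δ ε / log n` a union bound over the levels
gives the theorem.
-/

namespace RobustStreaming

/-! ### Hash families from random sampling -/

/-- The expectation of a product of independent, identically distributed factors. -/
theorem sum_pi_prod_mul_prod {ι Ω : Type*} [Fintype ι] [DecidableEq ι] [Fintype Ω]
    (w g : Ω → ℝ) :
    ∑ f : ι → Ω, (∏ i, w (f i)) * ∏ i, g (f i) = (∑ x, w x * g x) ^ Fintype.card ι := by
  simp_rw [← Finset.prod_mul_distrib]
  rw [← Finset.card_univ, ← Finset.prod_const, Finset.prod_univ_sum, Fintype.piFinset_univ]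

/-- Derandomization by sampling: if every one of finitely many bad events has weight at most
`δ / 4`, then some family indexed by `ι` meets each bad event in at most a `δ`-fraction of its
indices, as soon as `ι` is large enough for a union bound over the events. -/
theorem exists_family_card_bad_le {ι Ω 𝒮 : Type*} [Fintype ι] [DecidableEq ι] [Fintype Ω]
    [Fintype 𝒮] (w : Ω → ℝ) (hw0 : ∀ x, 0 ≤ w x) (hw1 : ∑ x, w x = 1) (bad : 𝒮 → Ω → Prop)
    [∀ s, DecidablePred (bad s)] {δ : ℝ} (hbad : ∀ s, ∑ x with bad s x, w x ≤ δ / 4)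
    (hcard : (Fintype.card 𝒮 : ℝ) * Real.exp (δ / 4 * Fintype.card ι)
      < (2 : ℝ) ^ (δ * Fintype.card ι)) :
    ∃ f : ι → Ω, ∀ s, ((Finset.univ.filter fun i => bad s (f i)).card : ℝ)
      ≤ δ * Fintype.card ι := by
  by_contra! hcon
  -- The random variable `∏ i, g s (f i)` is `2` to the number of bad indices.
  let g : 𝒮 → Ω → ℝ := fun s x => if bad s x then 2 else 1
  have hg : ∀ s (f : ι → Ω),
      ∏ i, g s (f i) = (2 : ℝ) ^ ((Finset.univ.filter fun i => bad s (f i)).card : ℝ) := by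
    intro s f
    simp only [g]
    rw [Finset.prod_ite]
    simp
  have hg0 : ∀ s (f : ι → Ω), 0 ≤ ∏ i, g s (f i) := fun s f => by rw [hg]; positivity
  have h1 : ∀ f : ι → Ω, (2 : ℝ) ^ (δ * Fintype.card ι) ≤ ∑ s, ∏ i, g s (f i) := by
    intro f
    obtain ⟨s, hs⟩ := hcon f
    refine le_trans ?_ (Finset.single_le_sum (fun s _ => hg0 s f) (Finset.mem_univ s))
    rw [hg]
    exact Real.rpow_le_rpow_of_exponent_le (by norm_num) hs.le
  have htot : ∑ f : ι → Ω, ∏ i, w (f i) = 1 := by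
    have := sum_pi_prod_mul_prod (ι := ι) w (fun _ => 1)
    simpa [hw1] using this
  have h2 : (2 : ℝ) ^ (δ * Fintype.card ι)
      ≤ ∑ f : ι → Ω, (∏ i, w (f i)) * ∑ s, ∏ i, g s (f i) := by
    calc (2 : ℝ) ^ (δ * Fintype.card ι)
        = ∑ f : ι → Ω, (∏ i, w (f i)) * (2 : ℝ) ^ (δ * Fintype.card ι) := by
          rw [← Finset.sum_mul, htot, one_mul]
      _ ≤ _ := Finset.sum_le_sum fun f _ =>
          mul_le_mul_of_nonneg_left (h1 f) (Finset.prod_nonneg fun i _ => hw0 _)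
  have h3 : ∀ s, ∑ x, w x * g s x ≤ 1 + δ / 4 := by
    intro s
    have : ∑ x, w x * g s x = ∑ x, w x + ∑ x with bad s x, w x := by
      rw [Finset.sum_filter, ← Finset.sum_add_distrib]
      refine Finset.sum_congr rfl fun x _ => ?_
      by_cases h : bad s x <;> simp [g, h]; ring
    rw [this, hw1]
    linarith [hbad s]
  have h4 : ∑ f : ι → Ω, (∏ i, w (f i)) * ∑ s, ∏ i, g s (f i)
      ≤ (Fintype.card 𝒮 : ℝ) * Real.exp (δ / 4 * Fintype.card ι) := by
    simp_rw [Finset.mul_sum]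
    rw [Finset.sum_comm]
    calc _ ≤ ∑ _s : 𝒮, Real.exp (δ / 4 * Fintype.card ι) := by
          refine Finset.sum_le_sum fun s _ => ?_
          rw [sum_pi_prod_mul_prod, mul_comm, Real.exp_nat_mul]
          refine pow_le_pow_left₀ (Finset.sum_nonneg fun x _ => mul_nonneg (hw0 x) ?_) ?_ _
          · simp only [g]; split_ifs <;> norm_num
          · linarith [h3 s, Real.add_one_le_exp (δ / 4)]
      _ = _ := by simp
  linarith

/-- The moment generating function of a binomial count, bounded by a quadratic exponent. -/
theorem sum_prod_mul_exp_card_le {ι Ω : Type*} [Fintype ι] [DecidableEq ι] [Fintype Ω]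
    (w : Ω → ℝ) (hw0 : ∀ x, 0 ≤ w x) (hw1 : ∑ x, w x = 1) (P : Ω → Prop) [DecidablePred P] {s : ℝ}
    (hs : |s| ≤ 1) :
    ∑ f : ι → Ω, (∏ i, w (f i)) * Real.exp (s * (Finset.univ.filter fun i => P (f i)).card)
      ≤ Real.exp (Fintype.card ι * (s * (∑ x with P x, w x) + s ^ 2)) := by
  have hz : ∑ x with P x, w x ≤ 1 := by
    rw [← hw1]
    exact Finset.sum_le_sum_of_subset_of_nonneg (Finset.filter_subset _ _) fun x _ _ => hw0 x
  have hz0 : 0 ≤ ∑ x with P x, w x := Finset.sum_nonneg fun x _ => hw0 x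
  have hg : ∀ f : ι → Ω, Real.exp (s * (Finset.univ.filter fun i => P (f i)).card)
      = ∏ i, (if P (f i) then Real.exp s else 1) := by
    intro f
    rw [Finset.prod_ite]
    simp [← Real.exp_nat_mul, mul_comm]
  simp_rw [hg]
  rw [sum_pi_prod_mul_prod w (fun x => if P x then Real.exp s else 1), Real.exp_nat_mul]
  have heq : ∑ x, w x * (if P x then Real.exp s else 1)
      = 1 + (∑ x with P x, w x) * (Real.exp s - 1) := by
    nth_rewrite 2 [← hw1]
    rw [Finset.sum_filter, Finset.sum_mul, ← Finset.sum_add_distrib]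
    refine Finset.sum_congr rfl fun x _ => ?_
    by_cases h : P x <;> simp [h]
    ring
  refine pow_le_pow_left₀ ?_ ?_ _
  · refine Finset.sum_nonneg fun x _ => mul_nonneg (hw0 x) ?_
    split_ifs
    · exact (Real.exp_pos _).le
    · norm_num
  · rw [heq]
    have h1 : Real.exp s - 1 ≤ s + s ^ 2 := by
      have := Real.abs_exp_sub_one_sub_id_le hs
      linarith [(abs_le.1 this).2]
    have h2 := mul_le_mul_of_nonneg_left h1 hz0
    have h3 : (∑ x with P x, w x) * s ^ 2 ≤ s ^ 2 := mul_le_of_le_one_left (sq_nonneg s) hz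
    refine le_trans ?_ (Real.add_one_le_exp _)
    nlinarith

/-- Upper Chernoff bound. -/
theorem sum_prod_filter_card_ge_le {ι Ω : Type*} [Fintype ι] [DecidableEq ι] [Fintype Ω]
    (w : Ω → ℝ) (hw0 : ∀ x, 0 ≤ w x) (hw1 : ∑ x, w x = 1) (P : Ω → Prop) [DecidablePred P] {θ d : ℝ}
    (hd0 : 0 ≤ d) (hd1 : d ≤ 1) (hθ : (∑ x with P x, w x) + d ≤ θ) :
    ∑ f : ι → Ω with θ * Fintype.card ι ≤ ((Finset.univ.filter fun i => P (f i)).card : ℝ),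
      ∏ i, w (f i) ≤ Real.exp (-(Fintype.card ι * (d / 2) ^ 2)) := by
  have hm := sum_prod_mul_exp_card_le (ι := ι) w hw0 hw1 P (s := d / 2)
    (by rw [abs_of_nonneg] <;> linarith)
  calc _ ≤ ∑ f : ι → Ω, (∏ i, w (f i)) *
        Real.exp (d / 2 * (Finset.univ.filter fun i => P (f i)).card)
          * Real.exp (-(d / 2 * (θ * Fintype.card ι))) := by
        rw [Finset.sum_filter]
        refine Finset.sum_le_sum fun f _ => ?_
        have hp : 0 ≤ ∏ i, w (f i) := Finset.prod_nonneg fun i _ => hw0 _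
        split_ifs with h
        · rw [mul_assoc, ← Real.exp_add]
          refine le_mul_of_one_le_right hp (Real.one_le_exp ?_)
          nlinarith
        · positivity
    _ ≤ Real.exp (Fintype.card ι * (d / 2 * (∑ x with P x, w x) + (d / 2) ^ 2))
          * Real.exp (-(d / 2 * (θ * Fintype.card ι))) := by
        rw [← Finset.sum_mul]
        exact mul_le_mul_of_nonneg_right hm (Real.exp_pos _).le
    _ ≤ _ := by
        rw [← Real.exp_add, Real.exp_le_exp]
        have hN : (0 : ℝ) ≤ Fintype.card ι := Nat.cast_nonneg _
        have := mul_le_mul_of_nonneg_left hθ (mul_nonneg hN (by linarith : 0 ≤ d / 2))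
        nlinarith

/-- Lower Chernoff bound. -/
theorem sum_prod_filter_card_le_le {ι Ω : Type*} [Fintype ι] [DecidableEq ι] [Fintype Ω]
    (w : Ω → ℝ) (hw0 : ∀ x, 0 ≤ w x) (hw1 : ∑ x, w x = 1) (P : Ω → Prop) [DecidablePred P] {θ d : ℝ}
    (hd0 : 0 ≤ d) (hd1 : d ≤ 1) (hθ : θ + d ≤ ∑ x with P x, w x) :
    ∑ f : ι → Ω with ((Finset.univ.filter fun i => P (f i)).card : ℝ) ≤ θ * Fintype.card ι,
      ∏ i, w (f i) ≤ Real.exp (-(Fintype.card ι * (d / 2) ^ 2)) := by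
  have hm := sum_prod_mul_exp_card_le (ι := ι) w hw0 hw1 P (s := -(d / 2))
    (by rw [abs_neg, abs_of_nonneg] <;> linarith)
  calc _ ≤ ∑ f : ι → Ω, (∏ i, w (f i)) *
        Real.exp (-(d / 2) * (Finset.univ.filter fun i => P (f i)).card)
          * Real.exp (d / 2 * (θ * Fintype.card ι)) := by
        rw [Finset.sum_filter]
        refine Finset.sum_le_sum fun f _ => ?_
        have hp : 0 ≤ ∏ i, w (f i) := Finset.prod_nonneg fun i _ => hw0 _
        split_ifs with h
        · rw [mul_assoc, ← Real.exp_add]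
          refine le_mul_of_one_le_right hp (Real.one_le_exp ?_)
          nlinarith
        · positivity
    _ ≤ Real.exp (Fintype.card ι * (-(d / 2) * (∑ x with P x, w x) + (-(d / 2)) ^ 2))
          * Real.exp (d / 2 * (θ * Fintype.card ι)) := by
        rw [← Finset.sum_mul]
        exact mul_le_mul_of_nonneg_right hm (Real.exp_pos _).le
    _ ≤ _ := by
        rw [← Real.exp_add, Real.exp_le_exp]
        have hN : (0 : ℝ) ≤ Fintype.card ι := Nat.cast_nonneg _
        have := mul_le_mul_of_nonneg_left hθ (mul_nonneg hN (by linarith : 0 ≤ d / 2))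
        nlinarith

/-- The weight of a subset of `Fin n` (given by its indicator) that contains every element
independently with probability `1 - q`. -/
def bernoulliWeight {n : ℕ} (q : ℝ) (g : Fin n → Bool) : ℝ :=
  ∏ i, if g i then 1 - q else q

theorem bernoulliWeight_nonneg {n : ℕ} {q : ℝ} (h0 : 0 ≤ q) (h1 : q ≤ 1) (g : Fin n → Bool) :
    0 ≤ bernoulliWeight q g :=
  Finset.prod_nonneg fun i _ => by split_ifs <;> linarith

/-- A random subset misses `S` with probability `q ^ #S`. -/
theorem sum_bernoulliWeight_avoid {n : ℕ} (q : ℝ) (S : Finset (Fin n)) :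
    ∑ g : Fin n → Bool with (∀ x ∈ S, g x = false), bernoulliWeight q g = q ^ S.card := by
  have h1 : ∀ g : Fin n → Bool,
      (if (∀ x ∈ S, g x = false) then bernoulliWeight q g else 0)
        = ∏ i, (if g i then (if i ∈ S then 0 else 1 - q) else q) := by
    intro g
    split_ifs with h
    · refine Finset.prod_congr rfl fun i _ => ?_
      by_cases hi : i ∈ S
      · simp [h i hi]
      · simp [hi]
    · push Not at h
      obtain ⟨x, hx, hgx⟩ := h
      refine (Finset.prod_eq_zero (Finset.mem_univ x) ?_).symm
      simp [hx, hgx]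
  rw [Finset.sum_filter, Finset.sum_congr rfl fun g _ => h1 g]
  have h2 := (Finset.prod_univ_sum (fun _ : Fin n => (Finset.univ : Finset Bool))
    (fun (i : Fin n) (b : Bool) => if b then (if i ∈ S then (0 : ℝ) else 1 - q) else q)).symm
  rw [Fintype.piFinset_univ] at h2
  rw [h2]
  have h3 : ∀ i : Fin n, (∑ b : Bool, if b then (if i ∈ S then (0 : ℝ) else 1 - q) else q)
      = if i ∈ S then q else 1 := by
    intro i
    by_cases hi : i ∈ S <;> simp [hi]
  rw [Finset.prod_congr rfl fun i _ => h3 i, Finset.prod_ite]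
  simp

theorem sum_bernoulliWeight {n : ℕ} (q : ℝ) : ∑ g : Fin n → Bool, bernoulliWeight q g = 1 := by
  classical
  simpa using sum_bernoulliWeight_avoid q (∅ : Finset (Fin n))

/-- The bitmap of a set `S` under a hash function: bit `b` records whether `S` meets the `b`-th
of the sets that make up the hash function. -/
def bitmap {n B : ℕ} (h : Fin B → Fin n → Bool) (S : Finset (Fin n)) : Fin B → Bool :=
  fun b => decide (∃ x ∈ S, h b x = true)

/-- A bitmap passes the threshold `θ` when at most `θ` of its bits are still zero. -/
def Fires {B : ℕ} (θ : ℝ) (m : Fin B → Bool) : Prop :=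
  ((Finset.univ.filter fun b => m b = false).card : ℝ) ≤ θ

theorem Fires.mono {n B : ℕ} {θ : ℝ} {h : Fin B → Fin n → Bool} {S T : Finset (Fin n)}
    (hST : S ⊆ T) (hS : Fires θ (bitmap h S)) : Fires θ (bitmap h T) := by
  refine le_trans ?_ hS
  exact_mod_cast Finset.card_le_card fun b hb => by
    simp only [bitmap, Finset.mem_filter, Finset.mem_univ, true_and, decide_eq_false_iff_not,
      not_exists, not_and] at hb ⊢
    exact fun x hx => hb x (hST hx)

open Classical in
/-- There are hash families with seeds of `r ≈ log (n / δ)` bits and bitmaps of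
`B ≈ log (1 / δ) / γ ^ 2` bits that separate the sets with at most `a` elements from those with at
least `(1 + γ) a`, up to a `δ`-fraction of the seeds.  With fully random hash functions the number
of zero bits is binomial with success probability `exp (-#S / a)`, and sampling `2 ^ r` of them
takes care of all `2 ^ n` sets `S` at once. -/
theorem exists_hash_family {n B r a : ℕ} (hn : 1 ≤ n) {γ δ : ℝ} (hγ0 : 0 < γ) (hγ1 : γ ≤ 1)
    (hδ0 : 0 < δ) (hδ1 : δ ≤ 1) (hB : 576 * Real.log (4 / δ) / γ ^ 2 ≤ B)
    (hr : 2 * (n : ℝ) ≤ δ * 2 ^ r) :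
    ∃ (h : (Fin r → Bool) → Fin B → Fin n → Bool) (θ : ℝ), ∀ S : Finset (Fin n),
      (S.card ≤ a →
        ((Finset.univ.filter fun σ => Fires θ (bitmap (h σ) S)).card : ℝ) ≤ δ * 2 ^ r) ∧
      (1 ≤ S.card → (1 + γ) * a ≤ S.card →
        ((Finset.univ.filter fun σ => ¬ Fires θ (bitmap (h σ) S)).card : ℝ) ≤ δ * 2 ^ r) := by
  have hlog : 0 < Real.log (4 / δ) := Real.log_pos (by rw [lt_div_iff₀ hδ0]; linarith)
  have hBpos : (0 : ℝ) < B := lt_of_lt_of_le (by positivity) hB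
  have hBpos' : 0 < B := by exact_mod_cast hBpos
  have hδr : 0 ≤ δ * 2 ^ r := by positivity
  rcases Nat.eq_zero_or_pos a with rfl | ha
  · -- The empty set is told from the others with certainty by constant hash functions.
    refine ⟨fun _ _ _ => true, 0, fun S => ⟨fun hS => ?_, fun hS _ => ?_⟩⟩
    · have : S = ∅ := Finset.card_eq_zero.1 (Nat.le_zero.1 hS)
      subst this
      simp [Fires, bitmap, hBpos'.ne', hδr]
    · obtain ⟨x, hx⟩ := Finset.card_pos.1 hS
      have : ∃ x, x ∈ S := ⟨x, hx⟩
      simp [Fires, bitmap, this, hδr]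
  · have ha' : (0 : ℝ) < a := by exact_mod_cast ha
    -- With this `q` a bit is still zero with probability `q ^ #S = exp (-#S / a)`; the threshold `θ`
    -- lies between `exp (-1)` and `exp (-(1 + γ))`, at distance at least `γ / 12` from both.
    set q : ℝ := Real.exp (-(1 / a)) with hq
    have hq0 : 0 ≤ q := (Real.exp_pos _).le
    have hq1 : q ≤ 1 := Real.exp_le_one_iff.2 (by simp)
    set θ : ℝ := Real.exp (-1) * (1 - γ / 4) with hθ
    have he : (1 : ℝ) / 3 < Real.exp (-1) := by
      rw [Real.exp_neg, one_div]
      exact inv_strictAnti₀ (Real.exp_pos _) (by linarith [Real.exp_one_lt_d9])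
    have he1 : Real.exp (-1) ≤ 1 := Real.exp_le_one_iff.2 (by norm_num)
    have hqS : ∀ S : Finset (Fin n), q ^ S.card = Real.exp (-(S.card / a)) := by
      intro S
      rw [hq, ← Real.exp_nat_mul]
      congr 1
      ring
    have htail : Real.exp (-(Fintype.card (Fin B) * (γ / 12 / 2) ^ 2)) ≤ δ / 4 := by
      rw [Fintype.card_fin]
      have h4 : δ / 4 = Real.exp (-Real.log (4 / δ)) := by
        rw [Real.exp_neg, Real.exp_log (by positivity), inv_div]
      rw [h4, Real.exp_le_exp, neg_le_neg_iff]
      rw [div_le_iff₀ (by positivity)] at hB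
      nlinarith
    -- The two ways to fail are exclusive, so that there is one bad event for each set `S`.
    let bad : Finset (Fin n) → (Fin B → Fin n → Bool) → Prop := fun S h =>
      (S.card ≤ a ∧ Fires (θ * B) (bitmap h S)) ∨
        ((1 + γ) * a ≤ S.card ∧ ¬ Fires (θ * B) (bitmap h S))
    have hzero : ∀ (S : Finset (Fin n)) (h : Fin B → Fin n → Bool),
        (Finset.univ.filter fun b => bitmap h S b = false)
          = Finset.univ.filter fun b => ∀ x ∈ S, h b x = false := by
      intro S h
      ext b
      simp [bitmap]
    have hw0 := bernoulliWeight_nonneg (n := n) hq0 hq1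
    have hw1 := sum_bernoulliWeight (n := n) q
    have hbad : ∀ S, ∑ h with bad S h, ∏ b, bernoulliWeight q (h b) ≤ δ / 4 := by
      intro S
      have hP := sum_bernoulliWeight_avoid q S
      rw [hqS] at hP
      by_cases hS : S.card ≤ a
      · refine le_trans ?_ htail
        refine le_trans (Finset.sum_le_sum_of_subset_of_nonneg ?_ fun h _ _ =>
          Finset.prod_nonneg fun b _ => hw0 _) (sum_prod_filter_card_le_le (ι := Fin B)
            (bernoulliWeight (n := n) q) hw0 hw1 (fun g => ∀ x ∈ S, g x = false) (θ := θ)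
            (d := γ / 12) (by positivity) (by linarith) ?_)
        · intro h hb
          simp only [Finset.mem_filter, Finset.mem_univ, true_and, Fintype.card_fin] at hb ⊢
          rcases hb with hb | hb
          · have := hb.2
            rwa [Fires, hzero] at this
          · have h1 : (S.card : ℝ) ≤ a := by exact_mod_cast hS
            nlinarith [hb.1]
        · rw [hP]
          have : Real.exp (-1) ≤ Real.exp (-(S.card / a)) := by
            rw [Real.exp_le_exp, neg_le_neg_iff, div_le_one ha']
            exact_mod_cast hS
          rw [hθ]
          nlinarith
      · by_cases hS2 : (1 + γ) * a ≤ S.card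
        · refine le_trans ?_ htail
          refine le_trans (Finset.sum_le_sum_of_subset_of_nonneg ?_ fun h _ _ =>
            Finset.prod_nonneg fun b _ => hw0 _) (sum_prod_filter_card_ge_le (ι := Fin B)
              (bernoulliWeight (n := n) q) hw0 hw1 (fun g => ∀ x ∈ S, g x = false) (θ := θ)
              (d := γ / 12) (by positivity) (by linarith) ?_)
          · intro h hb
            simp only [Finset.mem_filter, Finset.mem_univ, true_and, Fintype.card_fin] at hb ⊢
            rcases hb with hb | hb
            · exact absurd hb.1 hS
            · have := hb.2
              rw [Fires, hzero] at this
              exact (not_le.1 this).le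
          · rw [hP]
            have h1 : Real.exp (-(S.card / a)) ≤ Real.exp (-1) * Real.exp (-γ) := by
              rw [← Real.exp_add, Real.exp_le_exp]
              have : 1 + γ ≤ S.card / a := by rwa [le_div_iff₀ ha']
              linarith
            have h2 : Real.exp (-γ) ≤ 1 - γ / 2 := by
              have h3 := Real.add_one_le_exp γ
              have h5 : Real.exp (-γ) * (1 + γ + γ ^ 2 / 2) ≤ 1 := by
                rw [Real.exp_neg, inv_mul_le_one₀ (Real.exp_pos _)]
                exact Real.quadratic_le_exp_of_nonneg hγ0.le
              have h6 := Real.exp_pos (-γ)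
              have h7 : 1 ≤ (1 - γ / 2) * (1 + γ + γ ^ 2 / 2) := by nlinarith [mul_pos hγ0 hγ0]
              by_contra! h8
              nlinarith [mul_pos hγ0 hγ0]
            rw [hθ]
            nlinarith
        · rw [Finset.filter_false_of_mem]
          · rw [Finset.sum_empty]
            positivity
          · rintro h - (hb | hb)
            · exact hS hb.1
            · exact hS2 hb.1
    have hcard : (Fintype.card (Finset (Fin n)) : ℝ) *
        Real.exp (δ / 4 * Fintype.card (Fin r → Bool))
          < (2 : ℝ) ^ (δ * Fintype.card (Fin r → Bool)) := by
      rw [Fintype.card_finset, Fintype.card_fin]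
      simp only [Fintype.card_fun, Fintype.card_bool, Fintype.card_fin, Nat.cast_pow,
        Nat.cast_ofNat]
      rw [Real.rpow_def_of_pos (by norm_num), ← Real.exp_log (show (0 : ℝ) < 2 ^ n by positivity),
        ← Real.exp_add, Real.exp_lt_exp, Real.log_pow]
      have hl := Real.log_two_gt_d9
      have hl' := Real.log_two_lt_d9
      have hn' : (1 : ℝ) ≤ n := by exact_mod_cast hn
      nlinarith
    obtain ⟨h, hh⟩ := exists_family_card_bad_le (ι := Fin r → Bool)
      (fun h : Fin B → Fin n → Bool => ∏ b, bernoulliWeight q (h b))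
      (fun h => Finset.prod_nonneg fun b _ => hw0 _)
      (by simpa [hw1] using sum_pi_prod_mul_prod (ι := Fin B) (bernoulliWeight (n := n) q)
            (fun _ => 1))
      bad hbad hcard
    refine ⟨h, θ * B, fun S => ⟨fun hS => ?_, fun _ hS => ?_⟩⟩
    · refine le_trans ?_ (le_trans (hh S) (by simp))
      exact_mod_cast Finset.card_le_card fun σ hσ => by
        simp only [Finset.mem_filter, Finset.mem_univ, true_and] at hσ ⊢
        exact Or.inl ⟨hS, hσ⟩
    · refine le_trans ?_ (le_trans (hh S) (by simp))
      exact_mod_cast Finset.card_le_card fun σ hσ => by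
        simp only [Finset.mem_filter, Finset.mem_univ, true_and] at hσ ⊢
        exact Or.inr ⟨hS, hσ⟩

/-! ### The values of the responses -/

/-- The values `0 = a₀ < a₁ < …` that the algorithm reports: consecutive values are consecutive
integers at first, and then grow by a factor of about `1 + ε`. -/
noncomputable def levelValue (ε : ℝ) : ℕ → ℕ
  | 0 => 0
  | j + 1 => max (levelValue ε j + 1) ⌊(1 + ε) * levelValue ε j⌋₊

theorem levelValue_succ (ε : ℝ) (j : ℕ) :
    levelValue ε (j + 1) = max (levelValue ε j + 1) ⌊(1 + ε) * levelValue ε j⌋₊ := rfl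

theorem levelValue_lt_succ (ε : ℝ) (j : ℕ) : levelValue ε j < levelValue ε (j + 1) :=
  Nat.lt_of_succ_le (le_max_left _ _)

theorem strictMono_levelValue (ε : ℝ) : StrictMono (levelValue ε) :=
  strictMono_nat_of_lt_succ (levelValue_lt_succ ε)

theorem levelValue_succ_le {ε : ℝ} (hε : 0 ≤ ε) (j : ℕ) :
    (levelValue ε (j + 1) : ℝ) ≤ levelValue ε j + 1 + ε * levelValue ε j ∧
    (levelValue ε (j + 1) : ℝ) - 1 ≤ (1 + ε) * levelValue ε j := by
  have h0 : (0 : ℝ) ≤ levelValue ε j := Nat.cast_nonneg _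
  have hf := Nat.floor_le (show 0 ≤ (1 + ε) * (levelValue ε j : ℝ) by positivity)
  have hp : 0 ≤ ε * levelValue ε j := by positivity
  rw [levelValue_succ]
  rcases max_cases (levelValue ε j + 1) ⌊(1 + ε) * (levelValue ε j : ℝ)⌋₊ with h | h <;>
    rw [h.1] <;> push_cast <;> constructor <;> linarith

/-- Rounding down costs at most half of the growth, because the growth is at least `1`. -/
theorem mul_levelValue_le_succ {ε : ℝ} (j : ℕ) :
    (1 + ε / 2) * levelValue ε j ≤ levelValue ε (j + 1) := by
  have h0 : (0 : ℝ) ≤ levelValue ε j := Nat.cast_nonneg _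
  have h1 : ((levelValue ε j : ℝ) + 1) ≤ levelValue ε (j + 1) := by
    exact_mod_cast levelValue_lt_succ ε j
  have h2 : (1 + ε) * levelValue ε j - 1 ≤ levelValue ε (j + 1) := by
    have h3 := Nat.sub_one_lt_floor ((1 + ε) * (levelValue ε j : ℝ))
    have h4 : ((⌊(1 + ε) * (levelValue ε j : ℝ)⌋₊ : ℕ) : ℝ) ≤ levelValue ε (j + 1) := by
      exact_mod_cast le_max_right _ _
    linarith
  linarith

theorem pow_mul_levelValue_le {ε : ℝ} (hε : 0 ≤ ε) (j k : ℕ) :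
    (1 + ε / 2) ^ k * levelValue ε j ≤ levelValue ε (j + k) := by
  induction k with
  | zero => simp
  | succ k ih =>
    calc (1 + ε / 2) ^ (k + 1) * levelValue ε j
        = (1 + ε / 2) * ((1 + ε / 2) ^ k * levelValue ε j) := by ring
      _ ≤ (1 + ε / 2) * levelValue ε (j + k) := by gcongr
      _ ≤ _ := mul_levelValue_le_succ _

theorem levelValue_one (ε : ℝ) : levelValue ε 1 = 1 := by
  simp [levelValue]

/-- The value `a_j` is accurate for every count strictly between its two neighbours. -/
theorem abs_levelValue_sub_le {ε : ℝ} (hε : 0 ≤ ε) {j F : ℕ}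
    (hlo : ∀ i, j = i + 1 → levelValue ε i < F) (hhi : F < levelValue ε (j + 1)) :
    |(levelValue ε j : ℝ) - F| ≤ ε * F := by
  have hhi' : (F : ℝ) + 1 ≤ levelValue ε (j + 1) := by exact_mod_cast hhi
  rw [abs_le]
  constructor
  · rcases le_total (levelValue ε j) F with h | h
    · have h' : (levelValue ε j : ℝ) ≤ F := by exact_mod_cast h
      have := (levelValue_succ_le hε j).2
      nlinarith
    · have h' : (F : ℝ) ≤ levelValue ε j := by exact_mod_cast h
      have : 0 ≤ ε * (F : ℝ) := by positivity
      linarith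
  · cases j with
    | zero => simp only [levelValue]; push_cast; nlinarith [(Nat.cast_nonneg F : (0 : ℝ) ≤ F)]
    | succ i =>
      have h1 : (levelValue ε i : ℝ) + 1 ≤ F := by exact_mod_cast hlo i rfl
      have h2 := (levelValue_succ_le hε i).1
      nlinarith

/-- The number of distinct elements that the tester of level `i` may have missed when it is
started `w` levels ahead of its use. -/
noncomputable def missed (ε : ℝ) (w i : ℕ) : ℕ :=
  if i ≤ w then 0 else levelValue ε (i - w)

theorem missed_of_le {ε : ℝ} {w i : ℕ} (h : i ≤ w) : missed ε w i = 0 := if_pos h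

theorem missed_add (ε : ℝ) (w j : ℕ) : missed ε w (j + w) = levelValue ε j := by
  unfold missed
  split_ifs with h
  · have : j = 0 := by omega
    subst this
    rfl
  · simp

/-- If the count has reached `a_{i+1}`, then a tester that misses at most `missed ε w i` elements
has seen more than `(1 + ε / 4) a_i` of them. -/
theorem mul_levelValue_le_of_missed {ε : ℝ} (hε : 0 < ε) {w i s : ℕ}
    (hw : 4 / ε ≤ (1 + ε / 2) ^ w) (hs : levelValue ε (i + 1) ≤ s + missed ε w i) :
    1 ≤ s ∧ (1 + ε / 4) * levelValue ε i ≤ s ∧ levelValue ε i < s := by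
  have h0 : (0 : ℝ) ≤ levelValue ε i := Nat.cast_nonneg _
  have hs' : (levelValue ε (i + 1) : ℝ) ≤ s + missed ε w i := by exact_mod_cast hs
  have h1 := mul_levelValue_le_succ (ε := ε) i
  have hm : (missed ε w i : ℝ) ≤ ε / 4 * levelValue ε i := by
    unfold missed
    split_ifs with h
    · push_cast; positivity
    · have h2 := pow_mul_levelValue_le hε.le (i - w) w
      rw [Nat.sub_add_cancel (by omega)] at h2
      have h3 : (0 : ℝ) ≤ levelValue ε (i - w) := Nat.cast_nonneg _
      have h4 := mul_le_mul_of_nonneg_right hw h3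
      rw [div_mul_eq_mul_div, div_le_iff₀ hε] at h4
      nlinarith
  have h2 : (1 + ε / 4) * levelValue ε i ≤ s := by linarith
  refine (fun h3 : levelValue ε i < s => ⟨by omega, h2, h3⟩) ?_
  rcases Nat.eq_zero_or_pos i with rfl | hi
  · rw [missed_of_le (Nat.zero_le _)] at hs
    simp only [levelValue] at hs ⊢
    have := le_max_left (0 + 1) ⌊(1 + ε) * ((0 : ℕ) : ℝ)⌋₊
    omega
  · have hpos : 0 < levelValue ε i := by
      have := strictMono_levelValue ε hi
      omega
    have hpos' : (0 : ℝ) < levelValue ε i := by exact_mod_cast hpos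
    have : (levelValue ε i : ℝ) < s := by nlinarith
    exact_mod_cast this

/-! ### Averages over finite types -/

open scoped ENNReal

/-- The average of a function on a finite type. -/
noncomputable def avg {α : Type*} [Fintype α] (g : α → ℝ≥0∞) : ℝ≥0∞ :=
  ∑ a, (Fintype.card α : ℝ≥0∞)⁻¹ * g a

section Avg

variable {α β : Type*} [Fintype α] [Fintype β]

theorem avg_mono {f g : α → ℝ≥0∞} (h : ∀ a, f a ≤ g a) : avg f ≤ avg g :=
  Finset.sum_le_sum fun a _ => mul_le_mul_right (h a) _

theorem avg_add (f g : α → ℝ≥0∞) : avg (fun a => f a + g a) = avg f + avg g := by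
  simp only [avg, mul_add, Finset.sum_add_distrib]

theorem avg_const [Nonempty α] (c : ℝ≥0∞) : avg (fun _ : α => c) = c := by
  simp only [avg, Finset.sum_const, Finset.card_univ, nsmul_eq_mul, ← mul_assoc]
  rw [ENNReal.mul_inv_cancel (by simp) (by simp), one_mul]

theorem avg_mul_left (c : ℝ≥0∞) (f : α → ℝ≥0∞) : avg (fun a => c * f a) = c * avg f := by
  simp only [avg, Finset.mul_sum]
  exact Finset.sum_congr rfl fun a _ => by ring

theorem avg_mul_right (f : α → ℝ≥0∞) (c : ℝ≥0∞) : avg (fun a => f a * c) = avg f * c := by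
  simp only [avg, Finset.sum_mul, mul_assoc]

theorem avg_equiv (e : α ≃ β) (g : β → ℝ≥0∞) : avg (fun a => g (e a)) = avg g := by
  unfold avg
  rw [Fintype.card_congr e]
  exact e.sum_comp fun b => (Fintype.card β : ℝ≥0∞)⁻¹ * g b

theorem avg_prod (g : α × β → ℝ≥0∞) : avg g = avg fun a => avg fun b => g (a, b) := by
  simp only [avg, Fintype.sum_prod_type, Finset.mul_sum]
  refine Finset.sum_congr rfl fun a _ => Finset.sum_congr rfl fun b _ => ?_
  rw [Fintype.card_prod, Nat.cast_mul, ENNReal.mul_inv (by simp) (by simp), mul_assoc]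

theorem avg_tsum {ι : Type*} (g : ι → α → ℝ≥0∞) :
    avg (fun a => ∑' i, g i a) = ∑' i, avg (g i) := by
  simp only [avg, ← ENNReal.tsum_mul_left]
  exact (Summable.tsum_finsetSum fun _ _ => ENNReal.summable).symm

theorem avg_cons (k : ℕ) (g : (Fin (k + 1) → α) → ℝ≥0∞) :
    avg g = avg fun x => avg fun f : Fin k → α => g (Fin.cons x f) := by
  rw [← avg_equiv (Fin.consEquiv fun _ : Fin (k + 1) => α) g, avg_prod]
  rfl

theorem avg_snoc (k : ℕ) (g : (Fin (k + 1) → α) → ℝ≥0∞) :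
    avg g = avg fun x => avg fun f : Fin k → α => g (Fin.snoc (α := fun _ => α) f x) := by
  rw [← avg_equiv (Fin.snocEquiv fun _ : Fin (k + 1) => α) g, avg_prod]
  rfl

theorem avg_apply_zero [Nonempty α] (k : ℕ) (g : α → ℝ≥0∞) :
    (avg fun f : Fin (k + 1) → α => g (f 0)) = avg g := by
  rw [avg_cons]
  simp [avg_const]

theorem avg_apply_last [Nonempty α] (k : ℕ) (g : α → ℝ≥0∞) :
    (avg fun f : Fin (k + 1) → α => g (f (Fin.last k))) = avg g := by
  rw [avg_snoc]
  simp [avg_const]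

/-- Shifting a register of independent uniform entries and filling it up with a fresh uniform
entry gives a uniform register that is independent of the entry shifted out. -/
theorem avg_shift (k : ℕ) (A : α → ℝ≥0∞) (G : (Fin (k + 1) → α) → ℝ≥0∞) :
    (avg fun f : Fin (k + 1) → α => avg fun c : α =>
      A (f 0) * G (Fin.snoc (α := fun _ => α) (Fin.tail f) c)) = avg A * avg G := by
  rw [avg_cons, avg_snoc k G]
  simp only [Fin.cons_zero, Fin.tail_cons, avg_mul_left, avg_mul_right]
  congr 1
  have h := (avg_prod fun p : (Fin k → α) × α => G (Fin.snoc (α := fun _ => α) p.1 p.2))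
  rw [← h, ← avg_equiv (Equiv.prodComm _ _), avg_prod]
  rfl

end Avg

/-! ### Failure probabilities in the game -/

section Game

variable {n : ℕ}

theorem tsum_bind_mul {α β : Type*} (p : PMF α) (f : α → PMF β) (g : β → ℝ≥0∞) :
    ∑' b, p.bind f b * g b = ∑' a, p a * ∑' b, f a b * g b := by
  simp only [PMF.bind_apply, ← ENNReal.tsum_mul_right, ← ENNReal.tsum_mul_left]
  rw [ENNReal.tsum_comm]
  simp only [mul_assoc]

theorem tsum_map_mul {α β : Type*} (p : PMF α) (f : α → β) (g : β → ℝ≥0∞) :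
    ∑' b, p.map f b * g b = ∑' a, p a * g (f a) := by
  rw [PMF.map, tsum_bind_mul]
  refine tsum_congr fun a => ?_
  congr 1
  rw [tsum_eq_single (f a)]
  · simp
  · intro b hb
    simp [PMF.pure_apply, hb]

theorem tsum_fairCoins_mul (r : ℕ) (g : (Fin r → Bool) → ℝ≥0∞) :
    ∑' c, fairCoins r c * g c = avg g := by
  rw [tsum_fintype]
  simp [fairCoins, avg, PMF.uniformOfFintype_apply]

open Classical in
/-- The probability that an inaccurate response is given within the next `m` rounds (or was given
before), as a function of the current memory and transcript. -/
noncomputable def failProb (A : StreamingAlgorithm n) (adv : Adversary n) (ε : ℝ) :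
    ℕ → (Fin A.bits → Bool) → Transcript n → ℝ≥0∞
  | 0, _, h => if AllAccurate ε h then 0 else 1
  | m + 1, M, h => ∑' u, adv h u * avg fun c =>
      failProb A adv ε m (A.update M u c) (h ++ [(u, A.output (A.update M u c))])

theorem failProb_succ (A : StreamingAlgorithm n) (adv : Adversary n) (ε : ℝ) (m : ℕ)
    (M : Fin A.bits → Bool) (h : Transcript n) :
    failProb A adv ε (m + 1) M h = ∑' u, adv h u * avg fun c =>
      failProb A adv ε m (A.update M u c) (h ++ [(u, A.output (A.update M u c))]) := rfl

theorem failProb_le_one (A : StreamingAlgorithm n) (adv : Adversary n) (ε : ℝ) (m : ℕ)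
    (M : Fin A.bits → Bool) (h : Transcript n) : failProb A adv ε m M h ≤ 1 := by
  induction m generalizing M h with
  | zero => simp only [failProb]; split_ifs <;> simp
  | succ m ih =>
    simp only [failProb]
    calc _ ≤ ∑' u, adv h u * 1 := by
          refine ENNReal.tsum_le_tsum fun u => mul_le_mul_right ?_ _
          calc _ ≤ avg fun _ : Fin A.coins → Bool => (1 : ℝ≥0∞) := avg_mono fun c => ih _ _
            _ = 1 := avg_const 1
      _ = 1 := by simp [PMF.tsum_coe]

theorem tsum_game_mul_failProb (A : StreamingAlgorithm n) (adv : Adversary n) (ε : ℝ) (t m : ℕ) :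
    ∑' p, game A adv t p * failProb A adv ε m p.1 p.2
      = ∑' p, game A adv (t + m) p * failProb A adv ε 0 p.1 p.2 := by
  induction m generalizing t with
  | zero => rfl
  | succ m ih =>
    rw [show t + (m + 1) = (t + 1) + m by omega, ← ih (t + 1)]
    rw [game, tsum_bind_mul]
    refine tsum_congr fun p => ?_
    rw [tsum_bind_mul, failProb]
    congr 1
    refine tsum_congr fun u => ?_
    rw [tsum_map_mul, tsum_fairCoins_mul]

theorem robustDistinctElements_of_failProb_le {A : StreamingAlgorithm n} {ε δ : ℝ} (hδ : 0 ≤ δ)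
    (h : ∀ m adv, avg (fun c => failProb A adv ε m (A.init c) []) ≤ ENNReal.ofReal δ) :
    RobustDistinctElements A ε δ := by
  classical
  intro m adv
  have h1 := tsum_game_mul_failProb A adv ε 0 m
  rw [Nat.zero_add, game, tsum_map_mul, tsum_fairCoins_mul] at h1
  have h2 := h m adv
  simp only at h1
  rw [h1] at h2
  have h3 : (game A adv m).toOuterMeasure {p | AllAccurate ε p.2}
      + ∑' p, game A adv m p * failProb A adv ε 0 p.1 p.2 = 1 := by
    rw [PMF.toOuterMeasure_apply, ← ENNReal.tsum_add, ← PMF.tsum_coe (game A adv m)]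
    refine tsum_congr fun p => ?_
    by_cases hp : AllAccurate ε p.2 <;> simp [failProb, hp]
  rw [ENNReal.ofReal_sub _ hδ, ENNReal.ofReal_one, tsub_le_iff_right, ← h3]
  gcongr

end Game

/-! ### The set of distinct elements of a stream -/

section Stream

variable {n : ℕ}

/-- The set of distinct elements of a stream. -/
def support (us : List (Update n)) : Finset (Fin n) :=
  Finset.univ.filter fun i => freq us i ≠ 0

theorem l0_freq (us : List (Update n)) : l0 (freq us) = (support us).card := rfl

/-- The effect of an update on a set of distinct elements; updates with `Δ = 0` have none. -/
def ingest (u : Update n) (S : Finset (Fin n)) : Finset (Fin n) :=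
  if u.2 = 0 then S else insert u.1 S

theorem support_append (us : List (Update n)) (u : Update n) :
    support (us ++ [u]) = ingest u (support us) := by
  have h : ∀ i, freq (us ++ [u]) i = freq us i + if u.1 = i then u.2 else 0 := by
    intro i
    simp only [freq, List.filter_append, List.map_append, List.sum_append]
    by_cases hi : u.1 = i <;> simp [hi]
  ext i
  unfold ingest
  by_cases hu : u.2 = 0
  · simp [support, h, hu]
  · by_cases hi : u.1 = i
    · simp [support, h, hu, hi]
    · simp [support, h, hu, hi, Ne.symm hi]

theorem subset_ingest (u : Update n) (S : Finset (Fin n)) : S ⊆ ingest u S := by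
  unfold ingest
  split_ifs
  · exact subset_rfl
  · exact Finset.subset_insert _ _

theorem ingest_mono (u : Update n) {S T : Finset (Fin n)} (h : S ⊆ T) :
    ingest u S ⊆ ingest u T := by
  unfold ingest
  split_ifs
  · exact h
  · exact Finset.insert_subset_insert _ h

theorem card_ingest_le (u : Update n) (S : Finset (Fin n)) :
    (ingest u S).card ≤ S.card + 1 := by
  unfold ingest
  split_ifs
  · omega
  · exact Finset.card_insert_le _ _

/-- An update does not increase the number of elements that a subset misses. -/
theorem card_ingest_le_add (u : Update n) {S T : Finset (Fin n)} (h : S ⊆ T) {d : ℕ}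
    (hd : T.card ≤ S.card + d) : (ingest u T).card ≤ (ingest u S).card + d := by
  unfold ingest
  split_ifs
  · exact hd
  · by_cases hS : u.1 ∈ S
    · rwa [Finset.insert_eq_of_mem hS, Finset.insert_eq_of_mem (h hS)]
    · rw [Finset.card_insert_of_notMem hS]
      have := Finset.card_insert_le u.1 T
      omega

theorem AllAccurate.append {ε : ℝ} {h : Transcript n} (hh : AllAccurate ε h) {u : Update n} {R : ℚ}
    (hR : |(R : ℝ) - ((ingest u (support (h.map Prod.fst))).card : ℝ)|
      ≤ ε * (ingest u (support (h.map Prod.fst))).card) :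
    AllAccurate ε (h ++ [(u, R)]) := by
  intro t ht
  rw [List.length_append, List.length_singleton] at ht
  rcases Nat.lt_succ_iff_lt_or_eq.1 ht with h1 | h1
  · have h2 := hh t h1
    rw [List.take_append_of_le_length (by omega), List.getElem_append_left h1]
    exact h2
  · subst h1
    rw [List.take_of_length_le (by simp), l0_freq]
    simpa [support_append] using hR

end Stream

/-! ### The sketch-switching algorithm -/

/-- The parameters of the sketch-switching algorithm: it keeps `window + 1` testers, one for the
current level `j` and one for each of the next `window` levels; the levels are `0, …, top`.  The
tester of level `j` consists of a seed, which selects a hash function from the family `hash j`, and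
of a bitmap; it fires when at most `thr j` bits of the bitmap are zero. -/
structure Scheme (n : ℕ) where
  /-- the accuracy -/
  ε : ℝ
  /-- the number of testers in addition to the current one -/
  window : ℕ
  /-- the last level -/
  top : ℕ
  /-- the length of a seed -/
  seedBits : ℕ
  /-- the length of a bitmap -/
  width : ℕ
  /-- the hash families of the levels -/
  hash : ℕ → (Fin seedBits → Bool) → Fin width → Fin n → Bool
  /-- the thresholds of the levels -/
  thr : ℕ → ℝ

namespace Scheme

variable {n : ℕ} (P : Scheme n)

/-- The seeds of the hash functions. -/
abbrev Seed : Type := Fin P.seedBits → Bool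

/-- The contents of the memory: the current level, and a shift register of testers, whose `k`-th
entry belongs to the level `k` above the current one. -/
abbrev Mem : Type := Fin (P.top + 1) × (Fin (P.window + 1) → P.Seed × (Fin P.width → Bool))

/-- The memory at level `j` if the `k`-th tester has the seed `σ k` and has seen the set `S k`. -/
def memOf (j : Fin (P.top + 1)) (S : Fin (P.window + 1) → Finset (Fin n))
    (σ : Fin (P.window + 1) → P.Seed) : P.Mem :=
  (j, fun k => (σ k, bitmap (P.hash (j + k) (σ k)) (S k)))

/-- The tester of level `j` with seed `s` fires on the set `T`. -/
def FiresOn (j : ℕ) (s : P.Seed) (T : Finset (Fin n)) : Prop :=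
  Fires (P.thr j) (bitmap (P.hash j s) T)

/-- Shift a register, dropping its first entry and appending `c`. -/
def shift {α : Type*} {k : ℕ} (f : Fin (k + 1) → α) (c : α) : Fin (k + 1) → α :=
  Fin.snoc (α := fun _ => α) (Fin.tail f) c

/-- All bitmaps take in the update. -/
def absorb (M : P.Mem) (u : Update n) : P.Mem :=
  (M.1, fun k => ((M.2 k).1,
    if u.2 = 0 then (M.2 k).2
    else fun b => (M.2 k).2 b || P.hash (M.1 + k) (M.2 k).1 b u.1))

open Classical in
/-- One update: all bitmaps take it in, and if the current tester fires then the level is increased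
and a new tester is started with the fresh seed `c`. -/
noncomputable def step (M : P.Mem) (u : Update n) (c : P.Seed) : P.Mem :=
  if hj : M.1.val < P.top then
    if Fires (P.thr M.1) ((P.absorb M u).2 0).2 then
      (⟨M.1 + 1, by omega⟩, shift (P.absorb M u).2 (c, fun _ => false))
    else P.absorb M u
  else P.absorb M u

theorem bitmap_ingest {B : ℕ} (h : Fin B → Fin n → Bool) (u : Update n) (S : Finset (Fin n)) :
    bitmap h (ingest u S) = if u.2 = 0 then bitmap h S else fun b => bitmap h S b || h b u.1 := by
  unfold ingest
  split_ifs
  · rfl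
  · ext b
    rw [Bool.eq_iff_iff]
    simp [bitmap, or_comm]

theorem absorb_memOf (j : Fin (P.top + 1)) (S : Fin (P.window + 1) → Finset (Fin n))
    (σ : Fin (P.window + 1) → P.Seed) (u : Update n) :
    P.absorb (P.memOf j S σ) u = P.memOf j (fun k => ingest u (S k)) σ := by
  simp only [absorb, memOf, bitmap_ingest]

theorem shift_memOf (j : Fin (P.top + 1)) (j' : Fin (P.top + 1)) (hj : j'.val = j + 1)
    (S : Fin (P.window + 1) → Finset (Fin n)) (σ : Fin (P.window + 1) → P.Seed) (c : P.Seed) :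
    (j', shift (P.memOf j S σ).2 (c, fun _ => false)) = P.memOf j' (shift S ∅) (shift σ c) := by
  unfold memOf shift
  congr 1
  funext k
  induction k using Fin.lastCases with
  | last =>
    simp only [Fin.snoc_last]
    congr 1
    funext b
    simp [bitmap]
  | cast k =>
    simp only [Fin.snoc_castSucc, Fin.tail, Fin.val_succ, Fin.val_castSucc]
    rw [show j.val + (k.val + 1) = j'.val + k.val by omega]

theorem step_memOf_of_fires {j j' : Fin (P.top + 1)} (hj : j'.val = j + 1)
    {S : Fin (P.window + 1) → Finset (Fin n)} {σ : Fin (P.window + 1) → P.Seed} {u : Update n}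
    (h : P.FiresOn j (σ 0) (ingest u (S 0))) (c : P.Seed) :
    P.step (P.memOf j S σ) u c
      = P.memOf j' (shift (fun k => ingest u (S k)) ∅) (shift σ c) := by
  have h1 : (P.memOf j S σ).1.val < P.top := by
    have := j'.isLt
    change j.val < P.top
    omega
  have h2 : Fires (P.thr j) ((P.memOf j (fun k => ingest u (S k)) σ).2 0).2 := h
  unfold step
  rw [dif_pos h1, absorb_memOf, if_pos (show Fires (P.thr (P.memOf j S σ).1) _ from h2),
    ← P.shift_memOf j j' hj]
  congr 1
  exact Fin.ext hj.symm

theorem step_memOf_of_not_fires {j : Fin (P.top + 1)}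
    {S : Fin (P.window + 1) → Finset (Fin n)} {σ : Fin (P.window + 1) → P.Seed} {u : Update n}
    (h : ¬ P.FiresOn j (σ 0) (ingest u (S 0))) (c : P.Seed) :
    P.step (P.memOf j S σ) u c = P.memOf j (fun k => ingest u (S k)) σ := by
  have h2 : ¬ Fires (P.thr (P.memOf j S σ).1) ((P.memOf j (fun k => ingest u (S k)) σ).2 0).2 := h
  unfold step
  rw [absorb_memOf]
  split_ifs <;> rfl

/-- The number of bits of memory. -/
def bits : ℕ := Nat.clog 2 (P.top + 1) + (P.window + 1) * (P.seedBits + P.width)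

theorem exists_encoding : Nonempty (P.Mem ↪ (Fin P.bits → Bool)) := by
  apply Function.Embedding.nonempty_of_card_le
  have h : (P.top + 1) * (2 ^ P.seedBits * 2 ^ P.width) ^ (P.window + 1) ≤ 2 ^ P.bits := by
    rw [bits, pow_add 2 (Nat.clog _ _), mul_comm (P.window + 1), pow_mul, pow_add 2 P.seedBits]
    exact Nat.mul_le_mul (Nat.le_pow_clog (by norm_num) _) le_rfl
  simpa using h

/-- A fixed representation of the memory by bit strings. -/
noncomputable def enc : P.Mem ↪ (Fin P.bits → Bool) := P.exists_encoding.some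

/-- The inverse of `enc`, with an arbitrary value on strings that represent nothing. -/
noncomputable def dec : (Fin P.bits → Bool) → P.Mem := Function.invFun P.enc

theorem dec_enc (M : P.Mem) : P.dec (P.enc M) = M :=
  Function.leftInverse_invFun P.enc.injective M

/-- The coins of one step, read as one seed for each entry of the register. -/
def coinEquiv : (Fin ((P.window + 1) * P.seedBits) → Bool) ≃ (Fin (P.window + 1) → P.Seed) :=
  (finProdFinEquiv.symm.arrowCongr (Equiv.refl Bool)).trans (Equiv.curry _ _ _)

/-- The sketch-switching algorithm: it reports the value of the current level. -/
noncomputable def toAlgorithm : StreamingAlgorithm n where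
  bits := P.bits
  coins := (P.window + 1) * P.seedBits
  init c := P.enc (P.memOf 0 (fun _ => ∅) (P.coinEquiv c))
  update m u c := P.enc (P.step (P.dec m) u (P.coinEquiv c (Fin.last _)))
  output m := levelValue P.ε (P.dec m).1

/-! ### Consistency of memory and transcript -/

open Classical in
/-- The probability that the tester of level `j` fires on `T`. -/
noncomputable def fireProb (j : ℕ) (T : Finset (Fin n)) : ℝ≥0∞ :=
  avg fun s : P.Seed => if P.FiresOn j s T then 1 else 0

open Classical in
/-- The probability that the tester of level `j` does not fire on `T`. -/
noncomputable def quietProb (j : ℕ) (T : Finset (Fin n)) : ℝ≥0∞ :=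
  avg fun s : P.Seed => if P.FiresOn j s T then 0 else 1

/-- The requirements on the parameters, for testers with failure probability `d`. -/
structure Sound (d : ℝ≥0∞) : Prop where
  eps_nonneg : 0 ≤ P.ε
  le_top : n ≤ levelValue P.ε P.top
  fire_le : ∀ i ≤ P.top, ∀ T : Finset (Fin n), T.card ≤ levelValue P.ε i → P.fireProb i T ≤ d
  quiet_le : ∀ i ≤ P.top, ∀ T : Finset (Fin n),
    levelValue P.ε (i + 1) ≤ T.card + missed P.ε P.window i →
      levelValue P.ε i < T.card ∧ P.quietProb i T ≤ d

/-- The invariant of the analysis: at level `j`, with the testers having seen the sets `S k`, after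
the transcript `h`.  Past responses are only claimed to be accurate as long as the number of
distinct elements is below `a_{j+1}`, that is, as long as the current tester is not overdue. -/
structure Consistent (j : ℕ) (S : Fin (P.window + 1) → Finset (Fin n)) (h : Transcript n) :
    Prop where
  subset : ∀ k, S k ⊆ support (h.map Prod.fst)
  card_le : ∀ k : Fin (P.window + 1),
    (support (h.map Prod.fst)).card ≤ (S k).card + missed P.ε P.window (j + k)
  lower : ∀ i, j = i + 1 → levelValue P.ε i < (support (h.map Prod.fst)).card
  accurate : (support (h.map Prod.fst)).card < levelValue P.ε (j + 1) → AllAccurate P.ε h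

variable {P}

/-- The invariant survives a round in which the current tester does not fire. -/
theorem Consistent.stay {j : ℕ} {S : Fin (P.window + 1) → Finset (Fin n)} {h : Transcript n}
    (hε : 0 ≤ P.ε) (hc : P.Consistent j S h) (u : Update n) :
    P.Consistent j (fun k => ingest u (S k)) (h ++ [(u, (levelValue P.ε j : ℚ))]) := by
  have hsup : support ((h ++ [(u, (levelValue P.ε j : ℚ))]).map Prod.fst)
      = ingest u (support (h.map Prod.fst)) := by
    rw [List.map_append, List.map_singleton, support_append]
  have hle := Finset.card_le_card (subset_ingest u (support (h.map Prod.fst)))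
  refine ⟨fun k => ?_, fun k => ?_, fun i hi => ?_, fun hlt => ?_⟩
  · rw [hsup]
    exact ingest_mono u (hc.subset k)
  · rw [hsup]
    exact card_ingest_le_add u (hc.subset k) (hc.card_le k)
  · rw [hsup]
    exact (hc.lower i hi).trans_le hle
  · rw [hsup] at hlt
    refine (hc.accurate (hle.trans_lt hlt)).append ?_
    have := abs_levelValue_sub_le hε (fun i hi => (hc.lower i hi).trans_le hle) hlt
    simpa using this

/-- The invariant survives a round in which the current tester fires rightly.  The new tester misses
at most `a_{j+1}` elements, since the count grows by at most one in a round; for the same reason the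
next tester has not seen more than `a_{j+1}` elements. -/
theorem Consistent.advance {j : ℕ} {S : Fin (P.window + 1) → Finset (Fin n)} {h : Transcript n}
    (hε : 0 ≤ P.ε) (hc : P.Consistent j S h) {u : Update n}
    (hlt : (support (h.map Prod.fst)).card < levelValue P.ε (j + 1))
    (hfire : levelValue P.ε j < (ingest u (S 0)).card) :
    P.Consistent (j + 1) (shift (fun k => ingest u (S k)) ∅)
      (h ++ [(u, (levelValue P.ε (j + 1) : ℚ))]) ∧
    (shift (fun k => ingest u (S k)) ∅ 0).card ≤ levelValue P.ε (j + 1) := by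
  have hsup : support ((h ++ [(u, (levelValue P.ε (j + 1) : ℚ))]).map Prod.fst)
      = ingest u (support (h.map Prod.fst)) := by
    rw [List.map_append, List.map_singleton, support_append]
  have hle := card_ingest_le u (support (h.map Prod.fst))
  have hlow : levelValue P.ε j < (ingest u (support (h.map Prod.fst))).card :=
    hfire.trans_le (Finset.card_le_card (ingest_mono u (hc.subset 0)))
  have hsub : ∀ k, shift (fun k => ingest u (S k)) ∅ k
      ⊆ ingest u (support (h.map Prod.fst)) := by
    intro k
    unfold shift
    induction k using Fin.lastCases with
    | last => simp
    | cast k =>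
      rw [Fin.snoc_castSucc]
      exact ingest_mono u (hc.subset _)
  refine ⟨⟨fun k => ?_, fun k => ?_, fun i hi => ?_, fun _ => ?_⟩, ?_⟩
  · rw [hsup]
    exact hsub k
  · rw [hsup]
    unfold shift
    induction k using Fin.lastCases with
    | last =>
      rw [Fin.snoc_last, Fin.val_last, missed_add, Finset.card_empty]
      omega
    | cast k =>
      rw [Fin.snoc_castSucc]
      have := card_ingest_le_add u (hc.subset k.succ) (hc.card_le k.succ)
      rw [Fin.val_succ] at this
      rw [Fin.val_castSucc, show j + 1 + k.val = j + (k.val + 1) by omega]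
      exact this
  · rw [hsup]
    obtain rfl : j = i := by omega
    exact hlow
  · refine (hc.accurate hlt).append ?_
    have := abs_levelValue_sub_le (j := j + 1) hε (F := (ingest u (support (h.map Prod.fst))).card)
      (fun i hi => by obtain rfl : j = i := by omega
                      exact hlow)
      (by have := levelValue_lt_succ P.ε (j + 1); omega)
    simpa using this
  · have := Finset.card_le_card (hsub 0)
    omega

/-! ### Bounding the failure probability -/

theorem avg_coins_last (g : P.Seed → ℝ≥0∞) :
    (avg fun c : Fin P.toAlgorithm.coins → Bool => g (P.coinEquiv c (Fin.last _))) = avg g := by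
  rw [← avg_apply_last P.window g]
  exact avg_equiv P.coinEquiv fun f => g (f (Fin.last _))

variable (P) in
/-- The failure probability of the algorithm, as a function of its unencoded memory. -/
noncomputable def memFail (adv : Adversary n) (m : ℕ) (M : P.Mem) (h : Transcript n) : ℝ≥0∞ :=
  failProb P.toAlgorithm adv P.ε m (P.enc M) h

theorem memFail_le_one (adv : Adversary n) (m : ℕ) (M : P.Mem) (h : Transcript n) :
    P.memFail adv m M h ≤ 1 :=
  failProb_le_one _ _ _ _ _ _

theorem memFail_succ (adv : Adversary n) (m : ℕ) (M : P.Mem) (h : Transcript n) :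
    P.memFail adv (m + 1) M h = ∑' u, adv h u * avg fun c : P.Seed =>
      P.memFail adv m (P.step M u c) (h ++ [(u, (levelValue P.ε (P.step M u c).1 : ℚ))]) := by
  refine (failProb_succ P.toAlgorithm adv P.ε m (P.enc M) h).trans (tsum_congr fun u => ?_)
  rw [← avg_coins_last]
  simp only [memFail, toAlgorithm, dec_enc]

variable (P) in
/-- The bound for the probability of a failure at a level above `j`. -/
noncomputable def rest (d : ℝ≥0∞) (j : ℕ) : ℝ≥0∞ := ((P.top - j : ℕ) : ℝ≥0∞) * (2 * d)

theorem rest_eq (d : ℝ≥0∞) {j : ℕ} (hj : j < P.top) :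
    P.rest d j = P.rest d (j + 1) + 2 * d := by
  unfold rest
  rw [show P.top - j = (P.top - (j + 1)) + 1 by omega]
  push_cast
  ring

theorem fireProb_le_one (j : ℕ) (T : Finset (Fin n)) : P.fireProb j T ≤ 1 := by
  classical
  calc _ ≤ avg fun _ : P.Seed => (1 : ℝ≥0∞) := avg_mono fun s => by split_ifs <;> simp
    _ = 1 := avg_const 1

open Classical in
variable (P) in
/-- The probability, over the seeds, that the current tester does not fire on the set it has seen
and that an inaccurate response is given within `m` more rounds. -/
noncomputable def quietFail (adv : Adversary n) (m : ℕ) (j : Fin (P.top + 1))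
    (S : Fin (P.window + 1) → Finset (Fin n)) (h : Transcript n) : ℝ≥0∞ :=
  avg fun σ : Fin (P.window + 1) → P.Seed => (if P.FiresOn j (σ 0) (S 0) then 0 else 1) *
    P.memFail adv m (P.memOf j S σ) h

theorem quietFail_le_quietProb (adv : Adversary n) (m : ℕ) (j : Fin (P.top + 1))
    (S : Fin (P.window + 1) → Finset (Fin n)) (h : Transcript n) :
    P.quietFail adv m j S h ≤ P.quietProb j (S 0) := by
  classical
  unfold quietProb
  rw [← avg_apply_zero P.window]
  exact avg_mono fun σ => mul_le_of_le_one_right' (memFail_le_one _ _ _ _)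

/-- Without conditioning on the current tester being quiet. -/
theorem avg_memFail_le (adv : Adversary n) (m : ℕ) (j : Fin (P.top + 1))
    (S : Fin (P.window + 1) → Finset (Fin n)) (h : Transcript n) :
    (avg fun σ : Fin (P.window + 1) → P.Seed =>
      P.memFail adv m (P.memOf j S σ) h)
      ≤ P.quietFail adv m j S h + P.fireProb j (S 0) := by
  classical
  unfold quietFail fireProb
  rw [← avg_apply_zero P.window (fun s : P.Seed => if P.FiresOn j s (S 0) then 1 else 0), ← avg_add]
  refine avg_mono fun σ => ?_
  have := memFail_le_one adv m (P.memOf j S σ) h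
  split_ifs <;> simp [this]

open Classical in
variable (P) in
/-- The probability that a tester fires on `T` but not on `S`. -/
noncomputable def crossProb (j : ℕ) (S T : Finset (Fin n)) : ℝ≥0∞ :=
  avg fun s : P.Seed => if P.FiresOn j s T ∧ ¬ P.FiresOn j s S then 1 else 0

theorem fireProb_eq_add_crossProb (j : ℕ) {S T : Finset (Fin n)} (hST : S ⊆ T) :
    P.fireProb j T = P.fireProb j S + P.crossProb j S T := by
  classical
  unfold fireProb crossProb
  rw [← avg_add]
  congr 1
  funext s
  have hmono : P.FiresOn j s S → P.FiresOn j s T := Fires.mono hST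
  by_cases h1 : P.FiresOn j s S
  · simp [h1, hmono h1]
  · by_cases h2 : P.FiresOn j s T <;> simp [h1, h2]

variable (P) in
/-- The failure probability in `m` further rounds after a round with the update `u`, restricted to
the event that the current tester was quiet before that round. -/
noncomputable def quietFailAfter (adv : Adversary n) (m : ℕ) (j : Fin (P.top + 1))
    (S : Fin (P.window + 1) → Finset (Fin n)) (h : Transcript n) (u : Update n) : ℝ≥0∞ :=
  open Classical in
  avg fun σ : Fin (P.window + 1) → P.Seed => avg fun c : P.Seed =>
    (if P.FiresOn j (σ 0) (S 0) then 0 else 1) *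
      P.memFail adv m (P.step (P.memOf j S σ) u c)
        (h ++ [(u, (levelValue P.ε (P.step (P.memOf j S σ) u c).1 : ℚ))])

theorem quietFail_succ (adv : Adversary n) (m : ℕ) (j : Fin (P.top + 1))
    (S : Fin (P.window + 1) → Finset (Fin n)) (h : Transcript n) :
    P.quietFail adv (m + 1) j S h = ∑' u, adv h u * P.quietFailAfter adv m j S h u := by
  classical
  unfold quietFail quietFailAfter
  simp only [← avg_mul_left]
  rw [← avg_tsum]
  congr 1
  funext σ
  rw [memFail_succ, ← ENNReal.tsum_mul_left]
  refine tsum_congr fun u => ?_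
  simp only [avg_mul_left]
  ring

/-- If firing is a failure, all the mass of the seeds that fire now is lost. -/
theorem quietFailAfter_le_of_small (adv : Adversary n) (m : ℕ) (j : Fin (P.top + 1))
    (S : Fin (P.window + 1) → Finset (Fin n)) (h : Transcript n) (u : Update n) :
    P.quietFailAfter adv m j S h u
      ≤ P.quietFail adv m j (fun k => ingest u (S k)) (h ++ [(u, (levelValue P.ε j : ℚ))])
        + P.crossProb j (S 0) (ingest u (S 0)) := by
  classical
  unfold quietFail crossProb quietFailAfter
  rw [← avg_apply_zero P.window (fun s : P.Seed =>
    if P.FiresOn j s (ingest u (S 0)) ∧ ¬ P.FiresOn j s (S 0) then 1 else 0), ← avg_add]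
  refine avg_mono fun σ => ?_
  refine le_of_le_of_eq (avg_mono fun c => ?_) (avg_const _)
  by_cases h1 : P.FiresOn j (σ 0) (ingest u (S 0))
  · simp only [h1, true_and, if_true, zero_mul, zero_add, ite_not]
    exact mul_le_of_le_one_right' (memFail_le_one _ _ _ _)
  · have h2 : ¬ P.FiresOn j (σ 0) (S 0) := fun h2 => h1 (h2.mono (subset_ingest u _))
    rw [step_memOf_of_not_fires P h1]
    simp only [h1, h2, if_false, false_and, add_zero]
    exact le_rfl

/-- If the level is increased, the seeds of the later testers and the fresh seed are independent of
the event that the current tester fires now. -/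
theorem quietFailAfter_le_of_advance (adv : Adversary n) (m : ℕ) {j j' : Fin (P.top + 1)}
    (hj : j'.val = j + 1) (S : Fin (P.window + 1) → Finset (Fin n)) (h : Transcript n)
    (u : Update n) :
    P.quietFailAfter adv m j S h u
      ≤ P.quietFail adv m j (fun k => ingest u (S k)) (h ++ [(u, (levelValue P.ε j : ℚ))])
        + P.crossProb j (S 0) (ingest u (S 0)) *
          avg fun σ : Fin (P.window + 1) → P.Seed => P.memFail adv m
            (P.memOf j' (shift (fun k => ingest u (S k)) ∅) σ)
            (h ++ [(u, (levelValue P.ε j' : ℚ))]) := by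
  classical
  unfold quietFail crossProb quietFailAfter
  rw [← avg_shift, ← avg_add]
  refine avg_mono fun σ => ?_
  rw [← avg_const (α := P.Seed) (_ * _), ← avg_add]
  refine avg_mono fun c => ?_
  by_cases h1 : P.FiresOn j (σ 0) (ingest u (S 0))
  · rw [step_memOf_of_fires P hj h1]
    simp only [h1, true_and, if_true, zero_mul, zero_add, ite_not]
    exact le_rfl
  · have h2 : ¬ P.FiresOn j (σ 0) (S 0) := fun h2 => h1 (h2.mono (subset_ingest u _))
    rw [step_memOf_of_not_fires P h1]
    simp only [h1, h2, if_false, false_and, zero_mul, add_zero]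
    exact le_rfl

/-- A tester that is overdue has failed already. -/
theorem quietFail_bound_of_overdue {d : ℝ≥0∞} (hP : P.Sound d) (adv : Adversary n) (m : ℕ)
    {j : Fin (P.top + 1)} {S : Fin (P.window + 1) → Finset (Fin n)} {h : Transcript n}
    (hc : P.Consistent j S h)
    (hlate : levelValue P.ε (j + 1) ≤ (support (h.map Prod.fst)).card) :
    P.quietFail adv m j S h + P.fireProb j (S 0) * P.rest d j
        + (if (S 0).card ≤ levelValue P.ε j then P.fireProb j (S 0) else 0)
      ≤ P.rest d j + d + (if (S 0).card ≤ levelValue P.ε j then d else 0) := by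
  have hj : j.val ≤ P.top := Nat.lt_succ_iff.1 j.isLt
  obtain ⟨h1, h2⟩ := hP.quiet_le j hj (S 0) (hlate.trans (by simpa using hc.card_le 0))
  rw [if_neg (not_le.2 h1), if_neg (not_le.2 h1), add_zero, add_zero, add_comm (P.rest d j)]
  exact add_le_add ((quietFail_le_quietProb _ _ _ _ _).trans h2)
    (mul_le_of_le_one_left' (fireProb_le_one _ _))

/-- The main estimate, by induction on the number `m` of rounds to come.  The current tester may
still fail in two ways, by firing too early or by not firing in time, each of which costs `d`; the
part of the first cost that has been incurred already is `fireProb j (S 0)`, because it is known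
that the tester is quiet on `S 0`, and this is why it is on the left-hand side.  Seeds that fire now
move on to the next level and then only have to pay `rest`. -/
theorem quietFail_bound {d : ℝ≥0∞} (hP : P.Sound d) (adv : Adversary n) (m : ℕ)
    (j : Fin (P.top + 1)) (S : Fin (P.window + 1) → Finset (Fin n)) (h : Transcript n)
    (hc : P.Consistent j S h) :
    P.quietFail adv m j S h + P.fireProb j (S 0) * P.rest d j
        + (if (S 0).card ≤ levelValue P.ε j then P.fireProb j (S 0) else 0)
      ≤ P.rest d j + d + (if (S 0).card ≤ levelValue P.ε j then d else 0) := by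
  have hj (i : Fin (P.top + 1)) : i.val ≤ P.top := Nat.lt_succ_iff.1 i.isLt
  induction m generalizing j S h with
  | zero =>
    rcases le_or_gt (levelValue P.ε (j + 1)) (support (h.map Prod.fst)).card with hl | hl
    · exact quietFail_bound_of_overdue hP adv 0 hc hl
    · have hz : P.quietFail adv 0 j S h = 0 := by
        simp [quietFail, memFail, failProb, hc.accurate hl, avg]
      rw [hz, zero_add]
      refine add_le_add ((mul_le_of_le_one_left' (fireProb_le_one _ _)).trans le_self_add) ?_
      split_ifs with hs
      · exact hP.fire_le j (hj j) _ hs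
      · exact le_rfl
  | succ m ih =>
    rcases le_or_gt (levelValue P.ε (j + 1)) (support (h.map Prod.fst)).card with hl | hl
    · exact quietFail_bound_of_overdue hP adv _ hc hl
    -- It suffices to bound the contribution of each update the adversary may choose.
    suffices hu : ∀ u, P.quietFailAfter adv m j S h u + (P.fireProb j (S 0) * P.rest d j
        + (if (S 0).card ≤ levelValue P.ε j then P.fireProb j (S 0) else 0))
        ≤ P.rest d j + d + (if (S 0).card ≤ levelValue P.ε j then d else 0) by
      have hone (x : ℝ≥0∞) : ∑' u, adv h u * x = x := by
        rw [ENNReal.tsum_mul_right, PMF.tsum_coe, one_mul]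
      rw [add_assoc, quietFail_succ, ← hone (P.fireProb j (S 0) * P.rest d j + _),
        ← ENNReal.tsum_add]
      refine le_of_le_of_eq (ENNReal.tsum_le_tsum fun u => ?_) (hone _)
      rw [← mul_add]
      exact mul_le_mul_right (hu u) _
    intro u
    have hstay := ih j _ _ (hc.stay hP.eps_nonneg u)
    have hp := fireProb_eq_add_crossProb (P := P) j (subset_ingest u (S 0))
    have hle := Finset.card_le_card (subset_ingest u (S 0))
    rw [hp] at hstay
    by_cases hT : (ingest u (S 0)).card ≤ levelValue P.ε j
    · have hS : (S 0).card ≤ levelValue P.ε j := hle.trans hT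
      rw [if_pos hT, if_pos hT] at hstay
      rw [if_pos hS, if_pos hS]
      refine le_trans ?_ hstay
      refine (add_le_add_left (quietFailAfter_le_of_small adv m j S h u) _).trans ?_
      have hmono : P.fireProb j (S 0) * P.rest d j
          ≤ (P.fireProb j (S 0) + P.crossProb j (S 0) (ingest u (S 0))) * P.rest d j :=
        mul_le_mul_left le_self_add _
      refine (add_le_add_right (add_le_add_left hmono _) _).trans_eq ?_
      ring
    · -- The last level is never left, because there are at most `n ≤ a_top` elements.
      have hjtop : j.val < P.top := by
        refine lt_of_le_of_ne (hj j) fun hjt => hT ?_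
        rw [hjt]
        exact (Finset.card_le_univ _).trans ((Fintype.card_fin n).le.trans hP.le_top)
      let j' : Fin (P.top + 1) := ⟨j + 1, by omega⟩
      obtain ⟨hc', hcard⟩ := hc.advance hP.eps_nonneg hl (not_le.1 hT)
      have hnext := ih j' _ _ hc'
      rw [if_pos hcard, if_pos hcard] at hnext
      have havg := avg_memFail_le adv m j' (shift (fun k => ingest u (S k)) ∅)
        (h ++ [(u, (levelValue P.ε j' : ℚ))])
      have hρ : P.rest d j' + d + d = P.rest d j := by
        rw [rest_eq d hjtop]
        change P.rest d (j + 1) + d + d = _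
        ring
      have havg' := havg.trans (le_trans (by gcongr; exact le_self_add) (hnext.trans_eq hρ))
      rw [if_neg hT, if_neg hT, add_zero, add_zero] at hstay
      rw [← add_assoc]
      refine add_le_add ?_ ?_
      · refine le_trans ?_ hstay
        refine (add_le_add_left
          ((quietFailAfter_le_of_advance adv m (j' := j') rfl S h u).trans
            (add_le_add_right (mul_le_mul_right havg' _) _)) _).trans_eq ?_
        ring
      · split_ifs with hs
        · exact hP.fire_le j (hj j) _ hs
        · exact le_rfl

/-- The algorithm fails with probability at most `2 d` for each of its levels. -/
theorem robust_toAlgorithm {d : ℝ≥0∞} (hP : P.Sound d) {δ : ℝ} (hδ : 0 ≤ δ)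
    (hd : ((P.top + 1 : ℕ) : ℝ≥0∞) * (2 * d) ≤ ENNReal.ofReal δ) :
    RobustDistinctElements P.toAlgorithm P.ε δ := by
  refine robustDistinctElements_of_failProb_le hδ fun m adv => ?_
  have h0 : support (([] : Transcript n).map Prod.fst) = ∅ := by
    simp [support, freq]
  have hc : P.Consistent (0 : Fin (P.top + 1)) (fun _ => ∅) [] := by
    refine ⟨fun k => Finset.empty_subset _, fun k => by rw [h0]; simp, fun i hi => ?_,
      fun _ t ht => ?_⟩
    · simp at hi
    · simp at ht
  have hb := quietFail_bound hP adv m 0 _ _ hc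
  simp only [Finset.card_empty, zero_le, if_true] at hb
  have ha := avg_memFail_le (P := P) adv m 0 (fun _ => ∅) []
  rw [← avg_equiv P.coinEquiv] at ha
  refine (ha.trans (le_trans ?_ hb)).trans (le_of_eq_of_le ?_ hd)
  · gcongr
    exact le_self_add
  · unfold rest
    rw [show ((0 : Fin (P.top + 1)) : ℕ) = 0 from rfl, Nat.sub_zero]
    push_cast
    ring

end Scheme

/-! ### Choice of parameters and space -/

theorem le_pow_of_log_le {ε x : ℝ} (hε0 : 0 < ε) (hε1 : ε ≤ 1) (hx : 0 < x) {k : ℕ}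
    (hk : 4 * Real.log x / ε ≤ k) : x ≤ (1 + ε / 2) ^ k := by
  have h1 : Real.exp (ε / 4) ≤ 1 + ε / 2 := by
    have h := Real.abs_exp_sub_one_sub_id_le (x := ε / 4) (by rw [abs_of_pos] <;> linarith)
    have h' := (abs_le.1 h).2
    nlinarith
  calc x = Real.exp (Real.log x) := (Real.exp_log hx).symm
    _ ≤ Real.exp (k * (ε / 4)) := by
        rw [Real.exp_le_exp]
        rw [div_le_iff₀ hε0] at hk
        linarith
    _ = Real.exp (ε / 4) ^ k := Real.exp_nat_mul _ _
    _ ≤ _ := pow_le_pow_left₀ (Real.exp_pos _).le h1 k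

theorem log_le_logb_two {x : ℝ} (hx : 1 ≤ x) : Real.log x ≤ Real.logb 2 x := by
  rw [Real.logb, le_div_iff₀ (Real.log_pos (by norm_num))]
  exact mul_le_of_le_one_right (Real.log_nonneg hx) (by linarith [Real.log_two_lt_d9])

theorem avg_indicator_le {r : ℕ} {p : (Fin r → Bool) → Prop} [DecidablePred p] {d : ℝ}
    (h : ((Finset.univ.filter p).card : ℝ) ≤ d * 2 ^ r) :
    (avg fun s => if p s then 1 else 0) ≤ ENNReal.ofReal d := by
  unfold avg
  rw [← Finset.mul_sum, Finset.sum_boole, mul_comm, ← div_eq_mul_inv]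
  refine ENNReal.div_le_of_le_mul ?_
  rw [← ENNReal.ofReal_natCast, ← ENNReal.ofReal_natCast (Fintype.card _),
    ← ENNReal.ofReal_mul' (Nat.cast_nonneg _)]
  exact ENNReal.ofReal_le_ofReal (by simpa using h)

/-- A robust algorithm exists as soon as its window, number of levels, seed length and bitmap
length are large enough. -/
theorem exists_robust_algorithm {n : ℕ} (hn : 1 ≤ n) {ε δ : ℝ} (hε0 : 0 < ε) (hε1 : ε ≤ 1)
    (hδ0 : 0 < δ) (hδ1 : δ ≤ 1) {w J r B : ℕ} (hw : 4 * Real.log (4 / ε) / ε ≤ w)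
    (hJ : 4 * Real.log n / ε ≤ J) {d : ℝ} (hd : d = δ / (2 * (J + 2)))
    (hr : Real.logb 2 (2 * n / d) ≤ r) (hB : 9216 * Real.log (4 / d) / ε ^ 2 ≤ B) :
    ∃ A : StreamingAlgorithm n, RobustDistinctElements A ε δ ∧
      A.bits = Nat.clog 2 (J + 2) + (w + 1) * (r + B) := by
  classical
  have hn' : (1 : ℝ) ≤ n := by exact_mod_cast hn
  have hd0 : 0 < d := by rw [hd]; positivity
  have hd1 : d ≤ 1 := by
    rw [hd, div_le_one (by positivity)]
    have : (0 : ℝ) ≤ J := Nat.cast_nonneg _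
    linarith
  have hr' : 2 * (n : ℝ) ≤ d * 2 ^ r := by
    rw [Real.logb_le_iff_le_rpow (by norm_num) (by positivity), Real.rpow_natCast,
      div_le_iff₀ hd0] at hr
    linarith
  choose hash thr hht using fun i : ℕ => exists_hash_family (n := n) (B := B) (r := r)
    (a := levelValue ε i) hn (γ := ε / 4) (δ := d) (by positivity) (by linarith) hd0 hd1
    (by refine le_of_eq_of_le ?_ hB; field_simp; ring) hr'
  let P : Scheme n := ⟨ε, w, J + 1, r, B, hash, thr⟩
  refine ⟨P.toAlgorithm, Scheme.robust_toAlgorithm (P := P) (d := ENNReal.ofReal d) ⟨?_, ?_, ?_, ?_⟩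
    hδ0.le ?_, rfl⟩
  · exact hε0.le
  · have h1 := pow_mul_levelValue_le hε0.le 1 J
    rw [levelValue_one, Nat.cast_one, mul_one, add_comm 1 J] at h1
    exact_mod_cast (le_pow_of_log_le hε0 hε1 (by linarith) hJ).trans h1
  · intro i _ T hT
    exact avg_indicator_le ((hht i T).1 hT)
  · intro i _ T hT
    obtain ⟨h1, h2, h3⟩ := mul_levelValue_le_of_missed hε0
      (le_pow_of_log_le hε0 hε1 (by positivity) hw) hT
    refine ⟨h3, ?_⟩
    have := avg_indicator_le ((hht i T).2 h1 h2)
    simp only [ite_not] at this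
    exact this
  · rw [← ENNReal.ofReal_natCast, ← ENNReal.ofReal_ofNat, ← ENNReal.ofReal_mul (by norm_num),
      ← ENNReal.ofReal_mul (by positivity)]
    refine ENNReal.ofReal_le_ofReal (le_of_eq ?_)
    rw [hd]
    push_cast
    change ((J + 1 : ℕ) + 1 : ℝ) * _ = _
    push_cast
    field_simp
    ring

/-- Comparison of the space with the bound in terms of `a = log (1 / ε)`, `L = log (1 / ε) +
log (1 / δ) + log log n` and `l = log n`.  Constants are absorbed by the right-hand side because
`L ≥ 1` for `ε ≤ 1 / 2`, and `l ≥ 1`. -/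
theorem space_bound {ε a L l x w r B : ℝ} (hε0 : 0 < ε) (hε1 : ε < 1) (ha0 : 0 ≤ a) (haL : a ≤ L)
    (ha : ε ≤ 1 / 2 → 1 ≤ a) (hl : 1 ≤ l) (hx : x ≤ 4 + L)
    (hw : w ≤ 4 * (2 + a) / ε + 1)
    (hr0 : 0 ≤ r) (hr : r ≤ 6 + L + l) (hB0 : 0 ≤ B) (hB : B ≤ 9216 * (6 + L) / ε ^ 2 + 1) :
    x + (w + 1) * (r + B) ≤ 10 ^ 7 * ((1 + a) / ε * (L / ε ^ 2 + l)) := by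
  have hL0 : 0 ≤ L := ha0.trans haL
  set M := L / ε ^ 2 + l with hM
  have he2 : 0 < ε ^ 2 := by positivity
  have hinv1 : 1 ≤ 1 / ε := by rw [le_div_iff₀ hε0]; linarith
  have hinv2 : 1 ≤ 1 / ε ^ 2 := by rw [le_div_iff₀ he2]; nlinarith
  have hLM : L / ε ^ 2 ≤ M := by linarith
  have hL : L ≤ L / ε ^ 2 := by
    rw [le_div_iff₀ he2]
    exact mul_le_of_le_one_right hL0 (by nlinarith)
  have hM1 : 1 / ε ^ 2 ≤ 4 * M := by
    rcases le_total ε (1 / 2) with h | h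
    · have : 1 / ε ^ 2 ≤ L / ε ^ 2 := by
        gcongr
        exact (ha h).trans haL
      linarith [div_nonneg hL0 he2.le]
    · have : 1 / ε ^ 2 ≤ 4 := by
        rw [div_le_iff₀ he2]
        nlinarith
      linarith [div_nonneg hL0 he2.le]
  have hMl : l ≤ M := by linarith [div_nonneg hL0 he2.le]
  have hM0 : 1 ≤ M := hl.trans hMl
  have hQ : 1 ≤ (1 + a) / ε := by rw [le_div_iff₀ hε0]; linarith
  have hw' : w + 1 ≤ 10 * ((1 + a) / ε) := by
    have h1 : 4 * (2 + a) / ε + 2 * (1 / ε) ≤ 10 * ((1 + a) / ε) := by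
      rw [← sub_nonneg]
      have : 10 * ((1 + a) / ε) - (4 * (2 + a) / ε + 2 * (1 / ε)) = 6 * a / ε := by
        field_simp; ring
      rw [this]
      positivity
    linarith
  have hrB : r + B ≤ 300000 * M := by
    have h1 : 9216 * (6 + L) / ε ^ 2 = 9216 * 6 * (1 / ε ^ 2) + 9216 * (L / ε ^ 2) := by
      ring
    rw [h1] at hB
    linarith
  have h2 : (w + 1) * (r + B) ≤ 10 * ((1 + a) / ε) * (300000 * M) :=
    mul_le_mul hw' hrB (by linarith) (by positivity)
  have h3 : M ≤ (1 + a) / ε * M := le_mul_of_one_le_left (by linarith) hQ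
  linarith

end RobustStreaming

theorem mainTheorem4 :
    ∃ C : ℝ, 0 < C ∧
      ∀ (n : ℕ) (ε δ : ℝ), 2 ≤ n → 0 < ε → ε < 1 → 0 < δ → δ < 1 →
        ∃ A : RobustStreaming.StreamingAlgorithm n,
          RobustStreaming.RobustDistinctElements A ε δ ∧
          (A.bits : ℝ) ≤
            C * ((Real.logb 2 (2 / ε) / ε) *
              ((Real.logb 2 (1 / ε) + Real.logb 2 (1 / δ) + Real.logb 2 (Real.logb 2 (n : ℝ)))
                  / ε ^ 2
                + Real.logb 2 (n : ℝ))) := by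
  refine ⟨10 ^ 7, by norm_num, fun n ε δ hn hε0 hε1 hδ0 hδ1 => ?_⟩
  have hn' : (2 : ℝ) ≤ n := by exact_mod_cast hn
  have hlog_mul : ∀ {x y : ℝ}, 0 < x → 0 < y →
      Real.logb 2 (x * y) = Real.logb 2 x + Real.logb 2 y :=
    fun hx hy => Real.logb_mul hx.ne' hy.ne'
  have hlog2 : Real.logb 2 2 = 1 := Real.logb_self_eq_one (by norm_num)
  have hlog4 : Real.logb 2 4 = 2 := by
    rw [show (4 : ℝ) = 2 * 2 by norm_num, hlog_mul (by norm_num) (by norm_num), hlog2]; norm_num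
  have hlog8 : Real.logb 2 8 = 3 := by
    rw [show (8 : ℝ) = 4 * 2 by norm_num, hlog_mul (by norm_num) (by norm_num), hlog2, hlog4]
    norm_num
  have hεi : 1 ≤ 1 / ε := by rw [le_div_iff₀ hε0]; linarith
  have hδi : 1 ≤ 1 / δ := by rw [le_div_iff₀ hδ0]; linarith
  set a := Real.logb 2 (1 / ε) with ha
  set b := Real.logb 2 (1 / δ) with hb
  set l := Real.logb 2 (n : ℝ) with hl
  have hl1 : 1 ≤ l := by
    rw [hl, ← hlog2]
    exact Real.logb_le_logb_of_le (by norm_num) (by norm_num) hn'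
  have ha0 : 0 ≤ a := Real.logb_nonneg (by norm_num) hεi
  have hb0 : 0 ≤ b := Real.logb_nonneg (by norm_num) hδi
  have hc0 : 0 ≤ Real.logb 2 l := Real.logb_nonneg (by norm_num) hl1
  set L := a + b + Real.logb 2 l with hL
  have hl0 : 0 < l := by linarith
  set w := ⌈4 * Real.log (4 / ε) / ε⌉₊ with hw
  set J := ⌈4 * Real.log n / ε⌉₊ with hJ
  set d := δ / (2 * ((J : ℝ) + 2)) with hd
  set r := ⌈Real.logb 2 (2 * n / d)⌉₊ with hr
  set B := ⌈9216 * Real.log (4 / d) / ε ^ 2⌉₊ with hB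
  obtain ⟨A, hA, hbits⟩ := RobustStreaming.exists_robust_algorithm (n := n) (by omega) hε0 hε1.le
    hδ0 hδ1.le (Nat.le_ceil _ : _ ≤ (w : ℝ)) (Nat.le_ceil _ : _ ≤ (J : ℝ)) hd
    (Nat.le_ceil _ : _ ≤ (r : ℝ)) (Nat.le_ceil _ : _ ≤ (B : ℝ))
  refine ⟨A, hA, ?_⟩
  have hJ0 : (0 : ℝ) ≤ J := Nat.cast_nonneg _
  have hd0 : 0 < d := by positivity
  have hd1 : d ≤ 1 := by
    rw [hd, div_le_one (by positivity)]
    linarith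
  have hdi : 1 ≤ 1 / d := by rw [le_div_iff₀ hd0]; linarith
  have hJlog : Real.logb 2 ((J : ℝ) + 2) ≤ 3 + Real.logb 2 l + a := by
    rw [← hlog8, ← hlog_mul (by norm_num) hl0, ha, ← hlog_mul (by positivity) (by positivity)]
    refine Real.logb_le_logb_of_le (by norm_num) (by positivity) ?_
    have h1 := Nat.ceil_lt_add_one (show 0 ≤ 4 * Real.log n / ε by
      have := Real.log_nonneg (show (1 : ℝ) ≤ n by linarith)
      positivity)
    rw [← hJ] at h1
    have h2 : 4 * Real.log n / ε ≤ 4 * l / ε := by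
      gcongr
      exact RobustStreaming.log_le_logb_two (by linarith)
    have h3 : 1 ≤ l * (1 / ε) := by nlinarith
    have h4 : 4 * l / ε = 4 * (l * (1 / ε)) := by ring
    linarith
  have hdlog : Real.logb 2 (1 / d) ≤ 4 + L := by
    have h1 : 1 / d = 2 * ((J : ℝ) + 2) * (1 / δ) := by
      rw [hd]; field_simp
    rw [h1, hlog_mul (by positivity) (by positivity), hlog_mul (by norm_num) (by positivity), hlog2]
    linarith
  rw [show Real.logb 2 (2 / ε) = 1 + a by
    rw [show 2 / ε = 2 * (1 / ε) by ring, hlog_mul (by norm_num) (by positivity), hlog2]]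
  rw [hbits]
  push_cast
  have hlogn4 : ∀ x : ℝ, 1 ≤ 1 / x → 0 < x →
      Real.log (4 / x) ≤ 2 + Real.logb 2 (1 / x) ∧ 0 ≤ Real.log (4 / x) := by
    intro x hx hx0
    have h1 : 4 / x = 4 * (1 / x) := by ring
    have h2 : 1 ≤ 4 / x := by linarith
    refine ⟨(RobustStreaming.log_le_logb_two h2).trans_eq ?_, Real.log_nonneg h2⟩
    rw [h1, hlog_mul (by norm_num) (by positivity), hlog4]
  refine RobustStreaming.space_bound hε0 hε1 ha0 (by linarith) (fun h => ?_) hl1 ?_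
    ?_ (Nat.cast_nonneg _) ?_ (Nat.cast_nonneg _) ?_
  · rw [ha, ← hlog2]
    refine Real.logb_le_logb_of_le (by norm_num) (by norm_num) ?_
    rw [le_div_iff₀ hε0]
    linarith
  · rw [← Real.natCeil_logb_natCast]
    have h1 := Nat.ceil_lt_add_one (Real.logb_nonneg (b := 2) (x := ((J + 2 : ℕ) : ℝ))
      (by norm_num) (by push_cast; linarith))
    push_cast at h1 ⊢
    linarith
  · obtain ⟨h1, h2⟩ := hlogn4 ε hεi hε0
    refine (Nat.ceil_lt_add_one (by positivity)).le.trans ?_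
    gcongr
  · have h1 : 2 * (n : ℝ) / d = 2 * n * (1 / d) := by ring
    have h2 : Real.logb 2 (2 * (n : ℝ) / d) = 1 + l + Real.logb 2 (1 / d) := by
      rw [h1, hlog_mul (by positivity) (by positivity), hlog_mul (by norm_num) (by positivity),
        hlog2]
    have h3 : 0 ≤ Real.logb 2 (1 / d) := Real.logb_nonneg (by norm_num) hdi
    have h4 := Nat.ceil_lt_add_one (show 0 ≤ Real.logb 2 (2 * (n : ℝ) / d) by
      rw [h2]; linarith)
    rw [← hr] at h4
    linarith
  · obtain ⟨h1, h2⟩ := hlogn4 d hdi hd0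
    refine (Nat.ceil_lt_add_one (by positivity)).le.trans ?_
    gcongr
    linarith
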